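/- Let $n\ge 2$ and $m_1>m_2\ge m_3\ge\dots\ge m_n>0$. Consider $n$ point particles with masses $m_i$, positions $0\le q_1\le\dots\le q_n$, velocities $v_i$ and momenta $p_i=m_iv_i$ on the half line $\{q\ge 0\}$. Between collisions they fall freely, $\dot q_i=p_i/m_i$, $\dot p_i=-m_i$. When $q_i=q_{i+1}$, balls $i$ and $i+1$ collide elastically: with $\gamma_i=\frac{m_i-m_{i+1}}{m_i+m_{i+1}}$, $$p_i^+=\gamma_ip_i^-+(1+\gamma_i)p_{i+1}^-,\qquad p_{i+1}^+=(1-\gamma_i)p_i^--\gamma_ip_{i+1}^- .$$ When $q_1=0$, the lowest ball bounces off the floor: $p_1^+=-p_1^-$. Let $H=\sum_i\bigl(m_iq_i+\tfrac{p_i^2}{2m_i}\bigr)$, let $\mathbf M=\{(q,p): 0\le q_1\le\dots\le q_n,\ H(q,p)=1\}$, let $\psi^t$ be the resulting flow, and let $\mu$ be the Liouville measure on $\mathbf M$, i.e. the contraction $\iota_F(\omega^{\wedge n})$ of the $n$-th exterior power of $\omega=\sum_i dq_i\wedge dp_i$ by a vector field $F$ with $dH(F)=1$. Call $x=(q,p)\in\mathbf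 M$ nonsingular if $0<q_1<\dots<q_n$, all collisions on its positive orbit are simple (at each collision moment there is exactly one contact, either of two neighbouring balls or of the lowest ball with the floor, and the contact is not tangential), and the collision moments have no finite accumulation point. On tangent vectors $(\delta q,\delta p)$ at $x$ use the coordinates $\delta h_i=m_i\,\delta q_i+v_i\,\delta p_i$, $\delta v_i=\delta p_i/m_i$, and the quadratic form $Q(\delta h;\delta v)=\sum_i\delta h_i\,\delta v_i$. Let $\mathcal T_x$ be the space of tangent vectors with $\sum_i\delta h_i=\sum_i\delta v_i=0$. It is a complement to the flow direction in the tangent space of $\mathbf M$ at $x$, so that, modulo the flow direction, the linearization of the flow is a map $D\psi^t(x):\mathcal T_x\to\mathcal T_{\psi^t(x)}$. For nonsingular $x$ define the neutral space $$\mathcal N_x=\bigl\{(\delta h;0)\in\mathcal T_x : Q\bigl[D\psi^t(x)(\delta h;0)\bigr]=0\ \text{ for all } t\ge 0 \text{ that are not collision moments}\bigr\}.$$ Then $\mu$-almost every $x\in\mathbf M$ is nonsingular and satisfies $\mathcal N_x=\{0\}$. -/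

import Mathlib

open MeasureTheory Filter Topology
open scoped ENNReal

noncomputable section

namespace FallingBalls

/-- Phase points `(q, p)`: positions and momenta of `n` balls on the vertical line.
Tangent vectors `(δq, δp)` live in the same space.  The balls are numbered from `0` (the lowest). -/
abbrev Phase (n : ℕ) : Type := (Fin n → ℝ) × (Fin n → ℝ)

variable {n : ℕ}

/-- The velocities `v_i = p_i / m_i`. -/
def vel (m : Fin n → ℝ) (x : Phase n) (i : Fin n) : ℝ := x.2 i / m i

/-- The ball just below ball `k` (only used for `k ≠ 0`). -/
def below (k : Fin n) : Fin n := ⟨k.1 - 1, by omega⟩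

/-- The difference of the `k`-th entry of `u` and the entry just below it; the entry below the
lowest ball belongs to the floor and is `0`. -/
def gap (u : Fin n → ℝ) (k : Fin n) : ℝ := u k - (if k.1 = 0 then 0 else u (below k))

/-- The extended phase space `0 ≤ q_0 ≤ q_1 ≤ …`. -/
def phaseSpace (n : ℕ) : Set (Phase n) := {x | ∀ k, 0 ≤ gap x.1 k}

/-- Its interior `0 < q_0 < q_1 < …`: no ball is in contact with the floor or with another ball. -/
def phaseInterior (n : ℕ) : Set (Phase n) := {x | ∀ k, 0 < gap x.1 k}

/-- The total energy `H = ∑ (m_i q_i + p_i² / (2 m_i))`. -/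
def energy (m : Fin n → ℝ) (x : Phase n) : ℝ := ∑ i, (m i * x.1 i + x.2 i ^ 2 / (2 * m i))

/-- The energy surface `H = 1` in the extended phase space. -/
def energySurface (m : Fin n → ℝ) : Set (Phase n) := {x ∈ phaseSpace n | energy m x = 1}

/-! ### The Liouville measure on the energy surface -/

/-- The constant vector field `F = (∑ m_i)⁻¹ ∑ ∂/∂q_i`; it satisfies `dH (F) = 1`. -/
def normalField (m : Fin n → ℝ) : Phase n := (fun _ => (∑ i, m i)⁻¹, 0)

/-- The projection onto `{H = 1}` along the integral lines of `F`. -/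
def energyProj (m : Fin n → ℝ) (x : Phase n) : Phase n := x + (1 - energy m x) • normalField m

/-- The Liouville measure on the energy surface, that is, the contraction `ι_F (ω ∧ … ∧ ω)` of the
`n`-th exterior power of `ω = ∑ dq_i ∧ dp_i` (which is `n!` times Lebesgue measure) by a vector
field `F` with `dH (F) = 1`.  As `F` is constant, this contraction gives to a subset `A` of the
energy surface `n!` times the Lebesgue measure of the flow box `{a + s F | a ∈ A, 0 ≤ s ≤ 1}`, and
`H (a + s F) = 1 + s` there.  It is regarded as a measure on the ambient space, concentrated on the
energy surface. -/
def liouville (m : Fin n → ℝ) : Measure (Phase n) :=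
  (n.factorial : ℝ≥0∞) •
    ((volume.restrict
      {x | energyProj m x ∈ energySurface m ∧ energy m x ∈ Set.Icc (1 : ℝ) 2}).map (energyProj m))

/-! ### The flow with collisions -/

/-- Free fall during the time `t`: the solution of `q̇ = p / m`, `ṗ = - m`. -/
def fly (m : Fin n → ℝ) (t : ℝ) (x : Phase n) : Phase n :=
  (fun i => x.1 i + vel m x i * t - t ^ 2 / 2, fun i => x.2 i - m i * t)

/-- The Hamiltonian vector field `(∂H/∂p, - ∂H/∂q) = (v, - m)`. -/
def field (m : Fin n → ℝ) (x : Phase n) : Phase n := (vel m x, fun i => - m i)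

theorem hasDerivAt_fly (m : Fin n → ℝ) (hm : ∀ i, 0 < m i) (x : Phase n) (t : ℝ) :
    HasDerivAt (fun s => fly m s x) (field m (fly m t x)) t := by
  apply HasDerivAt.prodMk
  · rw [hasDerivAt_pi]
    intro i
    have h := (((hasDerivAt_id t).const_mul (vel m x i)).const_add (x.1 i)).sub
      (((hasDerivAt_id t).pow 2).div_const 2)
    refine h.congr_deriv ?_
    have := (hm i).ne'
    simp only [vel, fly, id]
    field_simp
    norm_num
    ring
  · rw [hasDerivAt_pi]
    intro i
    have h := ((hasDerivAt_id t).const_mul (m i)).const_sub (x.2 i)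
    refine h.congr_deriv ?_
    simp

/-- The phase point `x` is in a simple collision of type `k`, just before the impact: ball `k` is
in contact with the ball below it (with the floor, if `k = 0`) and approaches it, and there is no
other contact. -/
def IsSimpleCollision (m : Fin n → ℝ) (x : Phase n) (k : Fin n) : Prop :=
  gap x.1 k = 0 ∧ gap (vel m x) k < 0 ∧ ∀ l, l ≠ k → 0 < gap x.1 l

/-- `γ = (m_i - m_{i+1}) / (m_i + m_{i+1})` for the pair `i = below k`, `i + 1 = k`. -/
def massRatio (m : Fin n → ℝ) (k : Fin n) : ℝ := (m (below k) - m k) / (m (below k) + m k)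

/-- The law of elastic collisions of type `k`: the momentum of the lowest ball is reversed if
`k = 0`; otherwise the momenta of the balls `below k` and `k` become
`γ p_i + (1 + γ) p_{i+1}` and `(1 - γ) p_i - γ p_{i+1}`.  Positions do not change. -/
def collisionMap (m : Fin n → ℝ) (k : Fin n) (x : Phase n) : Phase n :=
  (x.1, fun j =>
    if k.1 = 0 then (if j = k then - x.2 k else x.2 j)
    else if j = below k then massRatio m k * x.2 (below k) + (1 + massRatio m k) * x.2 k
    else if j = k then (1 - massRatio m k) * x.2 (below k) - massRatio m k * x.2 k
    else x.2 j)

/-- The waiting time until the next contact. -/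
def waitTime (m : Fin n → ℝ) (x : Phase n) : ℝ :=
  sInf {t : ℝ | 0 < t ∧ ∃ k, gap (fly m t x).1 k = 0}

/-- The phase point at the next contact, just before the impact. -/
def impact (m : Fin n → ℝ) (x : Phase n) : Phase n := fly m (waitTime m x) x

open Classical in
/-- The phase point just after a collision; it is left undefined (equal to `x`) if the collision
is not simple. -/
def collide (m : Fin n → ℝ) (x : Phase n) : Phase n :=
  if h : ∃ k, IsSimpleCollision m x k then collisionMap m h.choose x else x

/-- The phase point just after the `j`-th collision of the positive orbit of `x`. -/
def postState (m : Fin n → ℝ) (x : Phase n) : ℕ → Phase n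
  | 0 => x
  | j + 1 => collide m (impact m (postState m x j))

/-- The moment of the `j`-th collision of the positive orbit of `x`; the moment number `0` is the
starting time `0`. -/
def collisionTime (m : Fin n → ℝ) (x : Phase n) : ℕ → ℝ
  | 0 => 0
  | j + 1 => collisionTime m x j + waitTime m (postState m x j)

open Classical in
/-- The flow `ψ^t x` for `t ≥ 0`: free fall after the last collision before `t`. At a collision
moment it is the phase point just after the collision. -/
def flow (m : Fin n → ℝ) (t : ℝ) (x : Phase n) : Phase n :=
  if h : ∃ j, collisionTime m x j ≤ t ∧ t < collisionTime m x (j + 1) then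
    fly m (t - collisionTime m x h.choose) (postState m x h.choose)
  else x

/-- The positive orbit of `x` is nonsingular: `t = 0` is not a moment of collision, all collisions
are simple, and the moments of collision have no finite accumulation point (so that the orbit is
defined for all `t ≥ 0`). -/
structure Nonsingular (m : Fin n → ℝ) (x : Phase n) : Prop where
  interior : x ∈ phaseInterior n
  simple : ∀ j, ∃ k, IsSimpleCollision m (impact m (postState m x j)) k
  unbounded : Tendsto (collisionTime m x) atTop atTop

/-! ### Tangent vectors, the quadratic form and the neutral space -/

/-- The coordinates `δh_i = m_i δq_i + v_i δp_i` of a tangent vector at `x`. -/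
def dh (m : Fin n → ℝ) (x ξ : Phase n) (i : Fin n) : ℝ := m i * ξ.1 i + vel m x i * ξ.2 i

/-- The coordinates `δv_i = δp_i / m_i` of a tangent vector. -/
def dv (m : Fin n → ℝ) (ξ : Phase n) (i : Fin n) : ℝ := ξ.2 i / m i

/-- The differential of the energy is `∑ δh_i`, so that `∑ δh_i = 0` describes the tangent space
of the energy surface. -/
theorem hasFDerivAt_energy (m : Fin n → ℝ) (x : Phase n) :
    ∃ L : Phase n →L[ℝ] ℝ, HasFDerivAt (energy m) L x ∧ ∀ ξ, L ξ = ∑ i, dh m x ξ i := by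
  have hq : ∀ i, HasFDerivAt (fun y : Phase n => y.1 i)
      ((ContinuousLinearMap.proj i).comp (ContinuousLinearMap.fst ℝ _ _)) x := fun i =>
    ((ContinuousLinearMap.proj (R := ℝ) (φ := fun _ : Fin n => ℝ) i).comp
      (ContinuousLinearMap.fst ℝ (Fin n → ℝ) (Fin n → ℝ))).hasFDerivAt
  have hp : ∀ i, HasFDerivAt (fun y : Phase n => y.2 i)
      ((ContinuousLinearMap.proj i).comp (ContinuousLinearMap.snd ℝ _ _)) x := fun i =>
    ((ContinuousLinearMap.proj (R := ℝ) (φ := fun _ : Fin n => ℝ) i).comp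
      (ContinuousLinearMap.snd ℝ (Fin n → ℝ) (Fin n → ℝ))).hasFDerivAt
  refine ⟨_, HasFDerivAt.fun_sum fun i _ =>
    ((hq i).const_mul (m i)).add (((hp i).pow 2).mul_const (2 * m i)⁻¹), ?_⟩
  intro ξ
  simp only [_root_.sum_apply]
  refine Finset.sum_congr rfl fun i _ => ?_
  simp [dh, vel]
  ring

/-- The space `𝒯_x`: vectors tangent to the energy surface with `∑ δv_i = 0`, a complement to the
flow direction. -/
def reducedTangent (m : Fin n → ℝ) (x : Phase n) : Submodule ℝ (Phase n) where
  carrier := {ξ | ∑ i, dh m x ξ i = 0 ∧ ∑ i, dv m ξ i = 0}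
  zero_mem' := by simp [dh, dv]
  add_mem' := by
    rintro a b ⟨ha, ha'⟩ ⟨hb, hb'⟩
    constructor
    · rw [← add_zero (0 : ℝ)]
      nth_rewrite 1 [← ha]
      rw [← hb, ← Finset.sum_add_distrib]
      exact Finset.sum_congr rfl fun i _ => by simp [dh]; ring
    · rw [← add_zero (0 : ℝ)]
      nth_rewrite 1 [← ha']
      rw [← hb', ← Finset.sum_add_distrib]
      exact Finset.sum_congr rfl fun i _ => by simp [dv]; ring
  smul_mem' := by
    rintro c a ⟨ha, ha'⟩
    constructor
    · rw [← mul_zero c, ← ha, Finset.mul_sum]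
      exact Finset.sum_congr rfl fun i _ => by simp [dh]; ring
    · rw [← mul_zero c, ← ha', Finset.mul_sum]
      exact Finset.sum_congr rfl fun i _ => by simp [dv]; ring

/-- The projection along the flow direction `V = (δh = 0, δv = (-1, …, -1))` to `∑ δv_i = 0`,
by which the quotient of the tangent space of the energy surface by the flow direction is
identified with `𝒯_x`. -/
def modFlow (m : Fin n → ℝ) (x ξ : Phase n) : Phase n := ξ + ((∑ i, dv m ξ i) / n) • field m x

/-- The linearization `Dψ^t (x) : 𝒯_x → 𝒯_{ψ^t x}`. -/
def dFlow (m : Fin n → ℝ) (t : ℝ) (x ξ : Phase n) : Phase n :=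
  modFlow m (flow m t x) (fderiv ℝ (flow m t) x ξ)

/-- The quadratic form `Q = ∑ δh_i δv_i` on tangent vectors at `x`. -/
def formQ (m : Fin n → ℝ) (x ξ : Phase n) : ℝ := ∑ i, dh m x ξ i * dv m ξ i

/-- The neutral space: the vectors `(δh; 0)` of `𝒯_x` with `Q (Dψ^t (δh; 0)) = 0` for all `t ≥ 0`,
where `t` is not a moment of collision (the linearization jumps at those, and is constant in the
coordinates `(δh; δv)` between them). -/
def neutralSpace (m : Fin n → ℝ) (x : Phase n) : Set (Phase n) :=
  {ξ | ξ ∈ reducedTangent m x ∧ (∀ i, dv m ξ i = 0) ∧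
    ∀ t : ℝ, 0 ≤ t → flow m t x ∈ phaseInterior n → formQ m (flow m t x) (dFlow m t x ξ) = 0}

end FallingBalls

end

noncomputable section

namespace FallingBalls

variable {n : ℕ}

/-! ### Gaps, impulses and reflections -/

/-! Write a vector with `δv = 0` as `(w, 0)`, so that `δh_i = m_i w_i` and `∑ m_i w_i = 0`. A
collision of two balls sends it to `(w', 0)`, where `w'` is the image of `w` under the reflection
that acts on the velocities, orthogonal for the mass scalar product. A floor collision at velocity
`g < 0` produces `Q = -2 m_1 w_1² / g`. Neutrality therefore forces the transported `w` to have `w_1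
= 0` at every floor collision, and the floor then leaves it unchanged (`formQ_floor`,
`mem_neutralSpace_step`).

For such `w`, the sums `∑ m_i w_i q_i` and `∑ m_i w_i v_i` do not jump at collisions. In free fall
the second is constant, because gravity contributes `∑ m_i w_i = 0`, and it is the derivative of the
first. The first is bounded, since energy bounds `q` and reflections preserve the norm of `w`. As
the orbit lasts for all times, `∑ m_i w_i v_i = 0` already at the start (`sum_mul_vel_eq_zero`).

For a fixed `w ≠ 0` this is a hyperplane in the momenta. The spaces of vectors neutral for longer
and longer collision words decrease, hence stabilize at a finite word. One test vector per word
suffices, so only countably many hyperplanes occur (`exists_testVector`).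

It remains to make almost every orbit nonsingular. Accumulation of collision moments is impossible
whenever all collisions are simple (`tendsto_collisionTime`). Multiple contacts are null by a
dimension count, transported through collisions by virtual states: each collision is replaced by a
locally smooth map with smooth inverse, namely passing the impact and then falling back to time zero
(`bypass`, `virt`). Finally the bad set is invariant under scaling, so its nullity in phase space
descends to the energy surface (`volume_flowBox_exceptional`). -/

theorem below_ne {k : Fin n} (hk : k.1 ≠ 0) : below k ≠ k := by
  intro h
  have := congrArg Fin.val h
  simp only [below] at this
  omega

/-- The indicator of the floor. -/
def floorInd (k : Fin n) : ℝ := if k.1 = 0 then 1 else 0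

theorem floorInd_nonneg (k : Fin n) : 0 ≤ floorInd k := by
  unfold floorInd; split_ifs <;> norm_num

theorem gap_add (u w : Fin n → ℝ) (k : Fin n) :
    gap (fun i => u i + w i) k = gap u k + gap w k := by
  unfold gap; split_ifs <;> ring

theorem gap_sub (u w : Fin n → ℝ) (k : Fin n) :
    gap (fun i => u i - w i) k = gap u k - gap w k := by
  unfold gap; split_ifs <;> ring

theorem gap_neg (u : Fin n → ℝ) (k : Fin n) : gap (fun i => - u i) k = - gap u k := by
  unfold gap; split_ifs <;> ring

theorem gap_const_mul (a : ℝ) (u : Fin n → ℝ) (k : Fin n) :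
    gap (fun i => a * u i) k = a * gap u k := by
  unfold gap; split_ifs <;> ring

theorem gap_mul_const (u : Fin n → ℝ) (a : ℝ) (k : Fin n) :
    gap (fun i => u i * a) k = gap u k * a := by
  unfold gap; split_ifs <;> ring

theorem gap_const (a : ℝ) (k : Fin n) : gap (fun _ => a) k = floorInd k * a := by
  unfold gap floorInd; split_ifs <;> ring

@[fun_prop]
theorem continuous_gap (k : Fin n) : Continuous fun u : Fin n → ℝ => gap u k := by
  unfold gap; split_ifs <;> fun_prop

/-- The gap as a continuous linear functional. -/
def gapL (k : Fin n) : (Fin n → ℝ) →L[ℝ] ℝ :=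
  LinearMap.toContinuousLinearMap
    { toFun := fun u => gap u k
      map_add' := fun u w => gap_add u w k
      map_smul' := fun a u => gap_const_mul a u k }

@[simp]
theorem gapL_apply (k : Fin n) (u : Fin n → ℝ) : gapL k u = gap u k := rfl

/-- The covector of the `k`-th gap. -/
def contact (k j : Fin n) : ℝ :=
  (if j = k then 1 else 0) - (if k.1 = 0 then 0 else if j = below k then 1 else 0)

theorem sum_mul_contact (u : Fin n → ℝ) (k : Fin n) : ∑ j, u j * contact k j = gap u k := by
  unfold contact gap
  split_ifs <;> simp [mul_sub, Finset.sum_sub_distrib]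

/-- Twice the reduced mass of the pair `below k`, `k` (of ball `k` and the floor if `k = 0`). -/
def redMass (m : Fin n → ℝ) (k : Fin n) : ℝ :=
  if k.1 = 0 then 2 * m k else 2 * m (below k) * m k / (m (below k) + m k)

/-- The direction in which a collision of type `k` changes the velocities. -/
def kick (m : Fin n → ℝ) (k j : Fin n) : ℝ := redMass m k * contact k j / m j

variable {m : Fin n → ℝ}

theorem redMass_pos (hm : ∀ i, 0 < m i) (k : Fin n) : 0 < redMass m k := by
  unfold redMass
  have h1 := hm k
  have h2 := hm (below k)
  split_ifs <;> positivity

/-- Up to the factor `redMass m k`, the kick is the gradient of the gap for the mass scalar product.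
-/
theorem sum_mul_kick (hm : ∀ i, 0 < m i) (u : Fin n → ℝ) (k : Fin n) :
    ∑ j, m j * (u j * kick m k j) = redMass m k * gap u k := by
  rw [← sum_mul_contact, Finset.mul_sum]
  refine Finset.sum_congr rfl fun j _ => ?_
  have := (hm j).ne'
  unfold kick
  field_simp

/-- The factor in `redMass` is chosen to give the value 2, which makes `reflect` an orthogonal
reflection in the hyperplane of zero gap. -/
theorem gap_kick (hm : ∀ i, 0 < m i) (k : Fin n) : gap (kick m k) k = 2 := by
  have h1 := hm k
  have h2 := hm (below k)
  unfold gap kick redMass contact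
  by_cases hk : k.1 = 0
  · simp only [hk, if_true]
    field_simp
    norm_num
  · simp only [hk, if_false, if_true, below_ne hk, (below_ne hk).symm]
    field_simp
    ring

/-- The reflection by which a collision of type `k` acts on the velocities. -/
def reflect (m : Fin n → ℝ) (k : Fin n) (u : Fin n → ℝ) : Fin n → ℝ :=
  fun j => u j - gap u k * kick m k j

theorem gap_sub_kick (hm : ∀ i, 0 < m i) (u : Fin n → ℝ) (a : ℝ) (k : Fin n) :
    gap (fun j => u j - a * kick m k j) k = gap u k - 2 * a := by
  rw [gap_sub u (fun j => a * kick m k j), gap_const_mul, gap_kick hm]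
  ring

theorem gap_reflect (hm : ∀ i, 0 < m i) (k : Fin n) (u : Fin n → ℝ) :
    gap (reflect m k u) k = - gap u k := by
  unfold reflect
  rw [gap_sub_kick hm]
  ring

/-- The effect of impulses of type `k` on the mass scalar product. -/
theorem sum_sub_kick_mul (hm : ∀ i, 0 < m i) (u w : Fin n → ℝ) (a b : ℝ) (k : Fin n) :
    ∑ j, m j * ((u j - a * kick m k j) * (w j - b * kick m k j)) =
      ∑ j, m j * (u j * w j) + redMass m k * (2 * a * b - a * gap w k - b * gap u k) := by
  have h1 := sum_mul_kick hm u k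
  have h2 := sum_mul_kick hm w k
  have h3 := sum_mul_kick hm (kick m k) k
  rw [gap_kick hm] at h3
  have : ∑ j, m j * ((u j - a * kick m k j) * (w j - b * kick m k j)) =
      ∑ j, m j * (u j * w j) - b * ∑ j, m j * (u j * kick m k j)
        - a * ∑ j, m j * (w j * kick m k j) + a * b * ∑ j, m j * (kick m k j * kick m k j) := by
    simp only [Finset.mul_sum, ← Finset.sum_sub_distrib, ← Finset.sum_add_distrib]
    exact Finset.sum_congr rfl fun j _ => by ring
  rw [this, h1, h2, h3]
  ring

theorem sum_reflect_mul (hm : ∀ i, 0 < m i) (u w : Fin n → ℝ) (k : Fin n) :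
    ∑ j, m j * (reflect m k u j * reflect m k w j) = ∑ j, m j * (u j * w j) := by
  unfold reflect
  rw [sum_sub_kick_mul hm]
  ring

/-! ### Free fall and collisions -/

theorem vel_fly (hm : ∀ i, 0 < m i) (t : ℝ) (x : Phase n) (i : Fin n) :
    vel m (fly m t x) i = vel m x i - t := by
  have := (hm i).ne'
  simp only [vel, fly]
  field_simp

theorem fly_fly (hm : ∀ i, 0 < m i) (s t : ℝ) (x : Phase n) :
    fly m s (fly m t x) = fly m (t + s) x := by
  refine Prod.ext (funext fun i => ?_) (funext fun i => ?_)
  · change (fly m t x).1 i + vel m (fly m t x) i * s - s ^ 2 / 2 = _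
    rw [vel_fly hm]
    simp only [fly]
    ring
  · simp only [fly]
    ring

theorem fly_zero (x : Phase n) : fly m 0 x = x := by
  refine Prod.ext (funext fun i => ?_) (funext fun i => ?_) <;> simp [fly]

theorem gap_vel_fly (hm : ∀ i, 0 < m i) (t : ℝ) (x : Phase n) (k : Fin n) :
    gap (vel m (fly m t x)) k = gap (vel m x) k - floorInd k * t := by
  have : vel m (fly m t x) = fun i => vel m x i - t := funext fun i => vel_fly hm t x i
  rw [this, gap_sub (vel m x) (fun _ => t), gap_const]

theorem gap_fly (t : ℝ) (x : Phase n) (k : Fin n) :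
    gap (fly m t x).1 k = gap x.1 k + gap (vel m x) k * t - floorInd k * (t ^ 2 / 2) := by
  have : (fly m t x).1 = fun i => (x.1 i + vel m x i * t) - t ^ 2 / 2 := rfl
  rw [this, gap_sub (fun i => x.1 i + vel m x i * t) (fun _ => t ^ 2 / 2),
    gap_add x.1 (fun i => vel m x i * t), gap_const, gap_mul_const]

@[fun_prop]
theorem continuous_vel : Continuous fun x : Phase n => vel m x := by
  unfold vel; fun_prop

@[fun_prop]
theorem continuous_fly : Continuous fun z : ℝ × Phase n => fly m z.1 z.2 := by
  unfold fly vel; fun_prop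

theorem vel_collisionMap (hm : ∀ i, 0 < m i) (k : Fin n) (x : Phase n) :
    vel m (collisionMap m k x) = reflect m k (vel m x) := by
  funext j
  have hj := hm j
  have hk := hm k
  have hb := hm (below k)
  by_cases h0 : k.1 = 0
  · by_cases hjk : j = k
    · subst hjk
      simp only [vel, collisionMap, reflect, kick, redMass, contact, gap, h0, if_true]
      field_simp
      ring
    · simp [vel, collisionMap, reflect, kick, redMass, contact, gap, h0, hjk]
  · by_cases hjb : j = below k
    · subst hjb
      simp only [vel, collisionMap, reflect, kick, redMass, contact, gap, massRatio, h0, if_true,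
        if_false, below_ne h0]
      field_simp
      ring
    · by_cases hjk : j = k
      · subst hjk
        simp only [vel, collisionMap, reflect, kick, redMass, contact, gap, massRatio, h0, if_true,
          if_false, hjb]
        field_simp
        ring
      · simp [vel, collisionMap, reflect, kick, redMass, contact, gap, h0, hjk, hjb]

theorem phase_ext (hm : ∀ i, 0 < m i) {x y : Phase n} (h1 : x.1 = y.1)
    (h2 : vel m x = vel m y) : x = y := by
  refine Prod.ext h1 (funext fun i => ?_)
  have := congrFun h2 i
  have hi := (hm i).ne'
  simp only [vel] at this
  field_simp at this
  exact this

theorem IsSimpleCollision.unique {x : Phase n} {k l : Fin n} (hk : IsSimpleCollision m x k)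
    (hl : IsSimpleCollision m x l) : k = l := by
  by_contra h
  exact (hl.2.2 k h).ne' hk.1

theorem collide_eq {x : Phase n} {k : Fin n} (hk : IsSimpleCollision m x k) :
    collide m x = collisionMap m k x := by
  have h : ∃ k, IsSimpleCollision m x k := ⟨k, hk⟩
  rw [collide, dif_pos h, h.choose_spec.unique hk]

/-! ### Weighted energies -/

/-- The energy with ball `i` counted with the weight `χ i`. -/
def weightedEnergy (m χ : Fin n → ℝ) (x : Phase n) : ℝ :=
  ∑ i, m i * (χ i * (x.1 i + vel m x i ^ 2 / 2))

theorem energy_eq (hm : ∀ i, 0 < m i) (x : Phase n) :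
    energy m x = weightedEnergy m (fun _ => 1) x := by
  refine Finset.sum_congr rfl fun i _ => ?_
  have := (hm i).ne'
  simp only [vel]
  field_simp

theorem weightedEnergy_fly (hm : ∀ i, 0 < m i) (χ : Fin n → ℝ) (t : ℝ) (x : Phase n) :
    weightedEnergy m χ (fly m t x) = weightedEnergy m χ x := by
  refine Finset.sum_congr rfl fun i _ => ?_
  rw [vel_fly hm]
  simp only [fly]
  ring

/-- The kick lives on the colliding pair, where the weight is a single scalar, and the kinetic
energy of that pair is preserved. At the floor only one ball is involved, so no condition on the
weight is needed. -/
theorem weightedEnergy_collisionMap (hm : ∀ i, 0 < m i) (χ : Fin n → ℝ) (k : Fin n)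
    (hχ : k.1 ≠ 0 → χ (below k) = χ k) (x : Phase n) :
    weightedEnergy m χ (collisionMap m k x) = weightedEnergy m χ x := by
  have key : ∀ u : Fin n → ℝ, ∑ j, m j * ((χ j * u j) * kick m k j) =
      redMass m k * (χ k * gap u k) := by
    intro u
    rw [sum_mul_kick hm]
    congr 1
    unfold gap
    split_ifs with h
    · ring
    · beta_reduce; rw [hχ h]; ring
  unfold weightedEnergy
  rw [vel_collisionMap hm]
  set v := vel m x
  set g := gap v k
  have h1 := key v
  have h2 := key (kick m k)
  rw [gap_kick hm] at h2
  have : ∑ i, m i * (χ i * ((collisionMap m k x).1 i + reflect m k v i ^ 2 / 2)) =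
      ∑ i, m i * (χ i * (x.1 i + v i ^ 2 / 2)) - g * ∑ j, m j * ((χ j * v j) * kick m k j)
      + g ^ 2 / 2 * ∑ j, m j * ((χ j * kick m k j) * kick m k j) := by
    simp only [Finset.mul_sum, ← Finset.sum_sub_distrib, ← Finset.sum_add_distrib]
    refine Finset.sum_congr rfl fun j _ => ?_
    simp only [collisionMap, reflect]
    ring
  rw [this, h1, h2]
  ring

/-! ### The next contact -/

/-- States from which the balls in contact separate. -/
def Outgoing (m : Fin n → ℝ) (y : Phase n) : Prop :=
  ∀ k, 0 ≤ gap y.1 k ∧ (gap y.1 k = 0 → 0 < gap (vel m y) k)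

theorem outgoing_of_interior {y : Phase n} (hy : y ∈ phaseInterior n) : Outgoing m y :=
  fun k => ⟨(hy k).le, fun h => absurd h (hy k).ne'⟩

/-- The set of the future contact moments. -/
def contactTimes (m : Fin n → ℝ) (y : Phase n) : Set ℝ :=
  {t : ℝ | 0 < t ∧ ∃ k, gap (fly m t y).1 k = 0}

theorem continuous_gap_fly (y : Phase n) (k : Fin n) :
    Continuous fun t : ℝ => gap (fly m t y).1 k := by
  have : Continuous fun t : ℝ => fly m t y :=
    continuous_fly.comp (continuous_id.prodMk continuous_const)
  exact (continuous_gap k).comp (continuous_fst.comp this)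

theorem Outgoing.eventually_pos {y : Phase n} (hy : Outgoing m y) :
    ∃ ε > 0, ∀ t, 0 < t → t < ε → ∀ k, 0 < gap (fly m t y).1 k := by
  have key : ∀ k, ∀ᶠ t in 𝓝[>] (0 : ℝ), 0 < gap (fly m t y).1 k := by
    intro k
    rcases (hy k).1.eq_or_lt with h | h
    · have hv := (hy k).2 h.symm
      have hc : ContinuousAt (fun t : ℝ => gap (vel m y) k - floorInd k * (t / 2)) 0 := by
        fun_prop
      have h0 : ∀ᶠ t in 𝓝 (0 : ℝ), 0 < gap (vel m y) k - floorInd k * (t / 2) :=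
        hc.eventually (lt_mem_nhds (by simpa using hv))
      filter_upwards [h0.filter_mono nhdsWithin_le_nhds, self_mem_nhdsWithin] with t ht ht0
      rw [gap_fly, ← h]
      have := mul_pos ht (show (0 : ℝ) < t from ht0)
      nlinarith
    · have hc := (continuous_gap_fly (m := m) y k).continuousAt (x := 0)
      have h0 : ∀ᶠ t in 𝓝 (0 : ℝ), 0 < gap (fly m t y).1 k :=
        hc.eventually (lt_mem_nhds (by beta_reduce; rw [fly_zero]; exact h))
      exact h0.filter_mono nhdsWithin_le_nhds
  have := eventually_all.2 key
  rw [eventually_nhdsWithin_iff, Metric.eventually_nhds_iff] at this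
  obtain ⟨ε, hε, h⟩ := this
  refine ⟨ε, hε, fun t h0 ht k => h ?_ h0 k⟩
  rw [Real.dist_eq, sub_zero, abs_of_pos h0]
  exact ht

theorem contactTimes_nonempty (hn : 0 < n) {y : Phase n} (hy : Outgoing m y) :
    (contactTimes m y).Nonempty := by
  set k : Fin n := ⟨0, hn⟩
  have hk : k.1 = 0 := rfl
  obtain ⟨hq, hv⟩ := hy k
  set q := gap y.1 k
  set v := gap (vel m y) k
  set s := √(v ^ 2 + 2 * q)
  have hs : s ^ 2 = v ^ 2 + 2 * q := Real.sq_sqrt (by positivity)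
  have hs0 : 0 ≤ s := Real.sqrt_nonneg _
  -- The lowest ball returns to the floor: this is the larger root of `q + v t - t² / 2`.
  refine ⟨v + s, ?_, k, ?_⟩
  · rcases hq.eq_or_lt with h | h
    · have := hv h.symm
      linarith
    · by_contra hc
      nlinarith
  · rw [gap_fly]
    simp only [floorInd, hk, if_true]
    change q + v * (v + s) - 1 * ((v + s) ^ 2 / 2) = 0
    nlinarith

theorem isLeast_waitTime (hn : 0 < n) {y : Phase n} (hy : Outgoing m y) :
    IsLeast (contactTimes m y) (waitTime m y) := by
  obtain ⟨ε, hε, h⟩ := hy.eventually_pos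
  -- Replacing `0 < t` by `ε ≤ t` exhibits the set as closed, so the infimum is attained.
  have hset : contactTimes m y = Set.Ici ε ∩ ⋃ k, {t | gap (fly m t y).1 k = 0} := by
    ext t
    simp only [contactTimes, Set.mem_ofPred_eq, Set.mem_inter_iff, Set.mem_Ici, Set.mem_iUnion]
    constructor
    · rintro ⟨h0, k, hk⟩
      exact ⟨by by_contra hc; exact (h t h0 (not_le.1 hc) k).ne' hk, k, hk⟩
    · rintro ⟨h0, k, hk⟩
      exact ⟨hε.trans_le h0, k, hk⟩
  have hcl : IsClosed (contactTimes m y) := by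
    rw [hset]
    exact isClosed_Ici.inter (isClosed_iUnion_of_finite fun k =>
      isClosed_eq (continuous_gap_fly y k) continuous_const)
  have hbd : BddBelow (contactTimes m y) := ⟨0, fun t ht => ht.1.le⟩
  exact ⟨hcl.csInf_mem (contactTimes_nonempty hn hy) hbd, fun t ht => csInf_le hbd ht⟩

theorem waitTime_pos (hn : 0 < n) {y : Phase n} (hy : Outgoing m y) : 0 < waitTime m y :=
  (isLeast_waitTime hn hy).1.1

theorem waitTime_nonneg (y : Phase n) : 0 ≤ waitTime m y :=
  Real.sInf_nonneg fun _ ht => ht.1.le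

theorem gap_fly_pos (hn : 0 < n) {y : Phase n} (hy : Outgoing m y) {t : ℝ} (h0 : 0 < t)
    (ht : t < waitTime m y) (k : Fin n) : 0 < gap (fly m t y).1 k := by
  by_contra hc
  push Not at hc
  obtain ⟨ε, hε, h⟩ := hy.eventually_pos
  have hs0 : 0 < min ε t / 2 := by positivity
  have hs1 : min ε t / 2 < ε := by linarith [min_le_left ε t]
  have hs2 : min ε t / 2 ≤ t := by linarith [min_le_right ε t]
  have hpos := h _ hs0 hs1 k
  obtain ⟨r, hr, hr0⟩ := intermediate_value_Icc' hs2
    (continuous_gap_fly (m := m) y k).continuousOn ⟨hc, hpos.le⟩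
  have : waitTime m y ≤ r := (isLeast_waitTime hn hy).2 ⟨hs0.trans_le hr.1, k, hr0⟩
  linarith [hr.2]

theorem gap_impact_nonneg (hn : 0 < n) {y : Phase n} (hy : Outgoing m y) (k : Fin n) :
    0 ≤ gap (impact m y).1 k := by
  have hw := waitTime_pos hn hy
  have : Tendsto (fun t : ℝ => gap (fly m t y).1 k) (𝓝[<] (waitTime m y))
      (𝓝 (gap (impact m y).1 k)) :=
    ((continuous_gap_fly (m := m) y k).tendsto _).mono_left nhdsWithin_le_nhds
  refine ge_of_tendsto this ?_
  filter_upwards [Ioo_mem_nhdsLT hw] with t ht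
  exact (gap_fly_pos hn hy ht.1 ht.2 k).le

/-- Contacts are never tangential. -/
theorem gap_vel_impact_neg (hm : ∀ i, 0 < m i) (hn : 0 < n) {y : Phase n} (hy : Outgoing m y)
    {k : Fin n} (hk : gap (impact m y).1 k = 0) : gap (vel m (impact m y)) k < 0 := by
  have hw := waitTime_pos hn hy
  -- The gap is concave in time. If it vanished at the impact without decreasing there, it could not
  -- have been positive at half the waiting time.
  have h := gap_fly_pos hn hy (half_pos hw) (half_lt_self hw) k
  have h2 : fly m (waitTime m y / 2) y = fly m (-(waitTime m y / 2)) (impact m y) := by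
    rw [impact, fly_fly hm]
    congr 1
    ring
  rw [h2, gap_fly, hk] at h
  have := floorInd_nonneg k
  by_contra hc
  push Not at hc
  nlinarith [mul_nonneg hc hw.le, mul_nonneg this (sq_nonneg (-(waitTime m y / 2)))]

/-- A contact at time `Δ`, before which all gaps but those closed at time `0` cannot vanish,
determines the waiting time. -/
theorem waitTime_eq (hn : 0 < n) {y : Phase n} (hy : Outgoing m y) {Δ : ℝ} (hΔ : 0 < Δ)
    (h : ∀ k, 0 ≤ gap (fly m Δ y).1 k) {k : Fin n} (hk : gap (fly m Δ y).1 k = 0) :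
    waitTime m y = Δ := by
  obtain ⟨⟨hw, l, hl⟩, hle⟩ := isLeast_waitTime hn hy
  refine le_antisymm (hle ⟨hΔ, k, hk⟩) ?_
  by_contra hc
  push Not at hc
  set w := waitTime m y
  have h1 := h l
  have hf := floorInd_nonneg l
  obtain ⟨ha, hb⟩ := hy l
  rw [gap_fly] at h1 hl
  set a := gap y.1 l
  set b := gap (vel m y) l
  set c := floorInd l
  have hd : 0 < Δ - w := by linarith
  -- A concave quadratic that is nonnegative at `0` and `Δ` and vanishes at `w` in between must
  -- vanish identically. The identity, obtained by eliminating `b`, gives `a = 0` and `c = 0`; then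
  -- `b * w = 0` contradicts `0 < b`.
  have e : a * (Δ - w) + c * (w * Δ * (Δ - w)) / 2 =
      - (w * (a + b * Δ - c * (Δ ^ 2 / 2))) := by
    linear_combination Δ * hl
  have p1 : 0 ≤ c * (w * Δ * (Δ - w)) := by positivity
  have p2 := mul_nonneg hw.le h1
  have p3 : a * (Δ - w) ≤ 0 := by linarith
  have ha0 : a = 0 := by
    by_contra hne
    have : 0 < a := lt_of_le_of_ne ha (Ne.symm hne)
    linarith [mul_pos this hd]
  have hb0 := hb ha0
  rw [ha0] at e hl p2
  have p4 : c * (w * Δ * (Δ - w)) = 0 := by linarith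
  have p5 : c = 0 := by
    rcases mul_eq_zero.1 p4 with h | h
    · exact h
    · have : 0 < w * Δ * (Δ - w) := by positivity
      linarith
  rw [p5] at hl
  have := mul_pos hb0 hw
  linarith

theorem outgoing_collisionMap (hm : ∀ i, 0 < m i) {x : Phase n} {k : Fin n}
    (hk : IsSimpleCollision m x k) : Outgoing m (collisionMap m k x) := by
  intro l
  by_cases h : l = k
  · subst h
    refine ⟨hk.1.ge, fun _ => ?_⟩
    rw [vel_collisionMap hm, gap_reflect hm]
    linarith [hk.2.1]
  · have := hk.2.2 l h
    exact ⟨this.le, fun h0 => absurd h0 this.ne'⟩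

theorem isSimpleCollision_impact (hm : ∀ i, 0 < m i) (hn : 0 < n) {y : Phase n}
    (hy : Outgoing m y)
    (h : ∀ k l, k ≠ l → ¬ (gap (impact m y).1 k = 0 ∧ gap (impact m y).1 l = 0)) :
    ∃ k, IsSimpleCollision m (impact m y) k := by
  obtain ⟨-, k, hk⟩ := (isLeast_waitTime hn hy).1
  refine ⟨k, hk, gap_vel_impact_neg hm hn hy hk, fun l hl => ?_⟩
  exact lt_of_le_of_ne (gap_impact_nonneg hn hy l) fun h0 => h l k hl ⟨h0.symm, hk⟩

/-! ### Virtual states: the collisions are undone by free fall backwards -/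

/-- The relative velocity at the impact of type `k` of a state in free fall. -/
def impactVel (m : Fin n → ℝ) (k : Fin n) (x : Phase n) : ℝ :=
  if k.1 = 0 then -√(gap (vel m x) k ^ 2 + 2 * gap x.1 k) else gap (vel m x) k

/-- Minus the product of the relative velocity at the impact of type `k` and the moment of this
impact, for a state in free fall. -/
def impactShift (m : Fin n → ℝ) (k : Fin n) (x : Phase n) : ℝ :=
  if k.1 = 0 then - (impactVel m k x * (gap (vel m x) k - impactVel m k x)) else gap x.1 k

/-- The moment of the impact of type `k` of a state in free fall. -/
def hitTime (m : Fin n → ℝ) (k : Fin n) (x : Phase n) : ℝ := - impactShift m k x / impactVel m k x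

/-- The state which in free fall agrees with the orbit of `x` after an impact of type `k`. -/
def bypass (m : Fin n → ℝ) (k : Fin n) (x : Phase n) : Phase n :=
  (fun j => x.1 j - impactShift m k x * kick m k j,
    fun j => x.2 j - impactVel m k x * (m j * kick m k j))

theorem vel_bypass (hm : ∀ i, 0 < m i) (k : Fin n) (x : Phase n) :
    vel m (bypass m k x) = fun j => vel m x j - impactVel m k x * kick m k j := by
  funext j
  have := (hm j).ne'
  simp only [vel, bypass]
  field_simp

/-- In free fall the relative velocity of two balls is constant, while the speed of the lowest ball
at the floor follows from its energy, with the negative root for a falling ball. -/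
theorem impactVel_eq (hm : ∀ i, 0 < m i) {k : Fin n} {x : Phase n} {T : ℝ}
    (h0 : gap (fly m T x).1 k = 0) (h1 : gap (vel m (fly m T x)) k < 0) :
    impactVel m k x = gap (vel m (fly m T x)) k := by
  rw [gap_vel_fly hm] at h1 ⊢
  rw [gap_fly] at h0
  unfold impactVel
  unfold floorInd at *
  split_ifs with hk
  · simp only [hk, if_true] at h0 h1 ⊢
    rw [show gap (vel m x) k ^ 2 + 2 * gap x.1 k = (-(gap (vel m x) k - 1 * T)) ^ 2 by nlinarith,
      Real.sqrt_sq (by linarith)]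
    ring
  · simp

theorem impactShift_eq (hm : ∀ i, 0 < m i) {k : Fin n} {x : Phase n} {T : ℝ}
    (h0 : gap (fly m T x).1 k = 0) (h1 : gap (vel m (fly m T x)) k < 0) :
    impactShift m k x = - (T * impactVel m k x) := by
  have h2 := impactVel_eq hm h0 h1
  rw [gap_vel_fly hm] at h2
  rw [gap_fly] at h0
  unfold impactShift
  unfold floorInd at *
  split_ifs with hk
  · simp only [hk, if_true] at h0 h2
    rw [h2]; ring
  · simp only [hk, if_false] at h0 h2
    rw [h2]; linarith

theorem hitTime_eq (hm : ∀ i, 0 < m i) {k : Fin n} {x : Phase n} {T : ℝ}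
    (h0 : gap (fly m T x).1 k = 0) (h1 : gap (vel m (fly m T x)) k < 0) :
    hitTime m k x = T := by
  have h2 := impactVel_eq hm h0 h1
  have h3 : impactVel m k x ≠ 0 := by rw [h2]; exact h1.ne
  unfold hitTime
  rw [impactShift_eq hm h0 h1]
  field_simp

theorem gap_vel_fly_hitTime (hm : ∀ i, 0 < m i) {k : Fin n} {x : Phase n}
    (h : impactVel m k x < 0) : gap (vel m (fly m (hitTime m k x) x)) k = impactVel m k x := by
  have hne := h.ne
  rw [gap_vel_fly hm, hitTime]
  unfold impactShift floorInd
  by_cases hk : k.1 = 0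
  · simp only [hk, if_true]
    field_simp
    ring
  · simp [hk, impactVel]

theorem gap_fly_hitTime {k : Fin n} {x : Phase n}
    (h : impactVel m k x < 0) : gap (fly m (hitTime m k x) x).1 k = 0 := by
  have hne := h.ne
  rw [gap_fly, hitTime]
  by_cases hk : k.1 = 0
  -- A strictly negative impact velocity means a positive square root, so the radicand is not in the
  -- range where `√` takes its default value.
  · have hs : impactVel m k x ^ 2 = gap (vel m x) k ^ 2 + 2 * gap x.1 k := by
      unfold impactVel at *
      simp only [hk, if_true] at h ⊢
      rw [neg_sq, Real.sq_sqrt]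
      exact (Real.sqrt_pos.1 (by linarith)).le
    have : - impactShift m k x / impactVel m k x = gap (vel m x) k - impactVel m k x := by
      simp only [impactShift, hk, if_true]
      field_simp
    rw [this]
    simp only [floorInd, hk, if_true]
    nlinarith
  · have : gap (vel m x) k = impactVel m k x := by simp [impactVel, hk]
    rw [this]
    simp only [floorInd, impactShift, hk, if_false]
    field_simp
    ring

/-- Changing the velocity by `-g • kick` at time `T` without moving the balls amounts to changing it
at time `0` and shifting the positions by `T g • kick`. The product `T g` is `-impactShift`, which
needs no division; this keeps `bypass` defined and continuous everywhere. -/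
theorem collisionMap_fly (hm : ∀ i, 0 < m i) {k : Fin n} {x : Phase n} {T : ℝ}
    (h0 : gap (fly m T x).1 k = 0) (h1 : gap (vel m (fly m T x)) k < 0) :
    collisionMap m k (fly m T x) = fly m T (bypass m k x) := by
  refine phase_ext hm (funext fun j => ?_) (funext fun j => ?_)
  · change x.1 j + vel m x j * T - T ^ 2 / 2 = (bypass m k x).1 j +
      vel m (bypass m k x) j * T - T ^ 2 / 2
    rw [vel_bypass hm]
    simp only [bypass]
    rw [impactShift_eq hm h0 h1]
    ring
  · rw [vel_collisionMap hm, vel_fly hm, vel_bypass hm]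
    simp only [reflect]
    rw [← impactVel_eq hm h0 h1, vel_fly hm]
    ring

@[fun_prop]
theorem continuous_impactVel (k : Fin n) : Continuous fun x : Phase n => impactVel m k x := by
  unfold impactVel; split_ifs <;> fun_prop

@[fun_prop]
theorem continuous_impactShift (k : Fin n) : Continuous fun x : Phase n => impactShift m k x := by
  unfold impactShift; split_ifs <;> fun_prop

@[fun_prop]
theorem continuous_bypass (k : Fin n) : Continuous fun x : Phase n => bypass m k x := by
  unfold bypass; fun_prop

theorem continuousAt_hitTime {k : Fin n} {x : Phase n} (h : impactVel m k x ≠ 0) :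
    ContinuousAt (fun x : Phase n => hitTime m k x) x := by
  unfold hitTime
  exact ((continuous_impactShift k).neg.continuousAt).div (continuous_impactVel k).continuousAt h

/-! ### Itineraries -/

/-- The virtual state after the collisions of the word `L`, whose head is the latest collision. -/
def virt (m : Fin n → ℝ) : List (Fin n) → Phase n → Phase n
  | [], x => x
  | k :: L, x => bypass m k (virt m L x)

/-- The first collisions of the orbit of `x` are simple and their types form the word `L`, whose
head is the latest collision. -/
def Follows (m : Fin n → ℝ) : List (Fin n) → Phase n → Prop
  | [], x => x ∈ phaseInterior n
  | k :: L, x => Follows m L x ∧ IsSimpleCollision m (impact m (postState m x L.length)) k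

/-- The word of the first collisions of a sequence of types. -/
def history (σ : ℕ → Fin n) : ℕ → List (Fin n)
  | 0 => []
  | j + 1 => σ j :: history σ j

@[simp]
theorem length_history (σ : ℕ → Fin n) (j : ℕ) : (history σ j).length = j := by
  induction j with
  | zero => rfl
  | succ j ih => simp [history, ih]

theorem Follows.post (hm : ∀ i, 0 < m i) {x : Phase n} : ∀ {L : List (Fin n)}, Follows m L x →
    postState m x L.length = fly m (collisionTime m x L.length) (virt m L x) ∧
      Outgoing m (postState m x L.length)
  | [], h => ⟨(fly_zero _).symm, outgoing_of_interior h⟩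
  | k :: L, h => by
    obtain ⟨h1, h2⟩ := Follows.post hm h.1
    have h3 : impact m (postState m x L.length) =
        fly m (collisionTime m x (L.length + 1)) (virt m L x) := by
      rw [impact, collisionTime]
      nth_rewrite 2 [h1]
      rw [fly_fly hm]
    have hs := h.2
    change collide m (impact m (postState m x L.length)) = _ ∧
      Outgoing m (collide m (impact m (postState m x L.length)))
    rw [collide_eq hs]
    refine ⟨?_, outgoing_collisionMap hm hs⟩
    rw [h3] at hs ⊢
    exact collisionMap_fly hm hs.1 hs.2.1

theorem Follows.impact_eq (hm : ∀ i, 0 < m i) {x : Phase n} {L : List (Fin n)}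
    (h : Follows m L x) : impact m (postState m x L.length) =
      fly m (collisionTime m x (L.length + 1)) (virt m L x) := by
  rw [impact, collisionTime]
  nth_rewrite 2 [(h.post hm).1]
  rw [fly_fly hm]

theorem Follows.impactVel_neg (hm : ∀ i, 0 < m i) {x : Phase n} {k : Fin n} {L : List (Fin n)}
    (h : Follows m (k :: L) x) : impactVel m k (virt m L x) < 0 := by
  have hs := h.2
  rw [h.1.impact_eq hm] at hs
  rw [impactVel_eq hm hs.1 hs.2.1]
  exact hs.2.1

theorem Follows.hitTime_eq (hm : ∀ i, 0 < m i) {x : Phase n} {k : Fin n} {L : List (Fin n)}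
    (h : Follows m (k :: L) x) :
    hitTime m k (virt m L x) = collisionTime m x (L.length + 1) := by
  have hs := h.2
  rw [h.1.impact_eq hm] at hs
  exact FallingBalls.hitTime_eq hm hs.1 hs.2.1

theorem Follows.interior {x : Phase n} : ∀ {L : List (Fin n)}, Follows m L x → x ∈ phaseInterior n
  | [], h => h
  | _ :: _, h => Follows.interior h.1

theorem Follows.postState_cons {x : Phase n} {k : Fin n} {L : List (Fin n)}
    (h : Follows m (k :: L) x) : postState m x (L.length + 1) =
      collisionMap m k (impact m (postState m x L.length)) :=
  collide_eq h.2

theorem Follows.energy_eq (hm : ∀ i, 0 < m i) {x : Phase n} : ∀ {L : List (Fin n)},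
    Follows m L x → energy m (postState m x L.length) = energy m x
  | [], _ => rfl
  | k :: L, h => by
    rw [List.length_cons, h.postState_cons, FallingBalls.energy_eq hm,
      weightedEnergy_collisionMap hm _ _ (fun _ => rfl), impact, weightedEnergy_fly hm,
      ← FallingBalls.energy_eq hm, Follows.energy_eq hm h.1]

/-- The free falls to all the impacts of the word meet their contacts transversally. -/
def Regular (m : Fin n → ℝ) : List (Fin n) → Phase n → Prop
  | [], _ => True
  | k :: L, x => Regular m L x ∧ impactVel m k (virt m L x) ≠ 0

theorem Follows.regular (hm : ∀ i, 0 < m i) {x : Phase n} : ∀ {L : List (Fin n)},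
    Follows m L x → Regular m L x
  | [], _ => trivial
  | _ :: _, h => ⟨Follows.regular hm h.1, (h.impactVel_neg hm).ne⟩

/-- The states whose free fall leads to a multiple contact. -/
def doubleContact (m : Fin n → ℝ) : Set (Phase n) :=
  {x | ∃ k l, k ≠ l ∧ ∃ t, gap (fly m t x).1 k = 0 ∧ gap (fly m t x).1 l = 0}

/-- Outgoing states reach a next contact, and that contact is never tangential, so only a double
contact can break the induction. The hypothesis ranges over all regular words, whether or not the
orbit realizes them, so that its failure is a countable union of explicit sets. -/
theorem exists_follows (hm : ∀ i, 0 < m i) (hn : 0 < n) {x : Phase n}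
    (hx : x ∈ phaseInterior n) (h : ∀ L, Regular m L x → virt m L x ∉ doubleContact m) :
    ∃ σ : ℕ → Fin n, ∀ j, Follows m (history σ j) x := by
  have step : ∀ L, Follows m L x →
      ∃ k, IsSimpleCollision m (impact m (postState m x L.length)) k := by
    intro L hL
    refine isSimpleCollision_impact hm hn (hL.post hm).2 fun k l hkl hc => ?_
    rw [hL.impact_eq hm] at hc
    exact h L (hL.regular hm) ⟨k, l, hkl, _, hc⟩
  have all : ∀ j, ∃ L : List (Fin n), L.length = j ∧ Follows m L x := by
    intro j
    induction j with
    | zero => exact ⟨[], rfl, hx⟩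
    | succ j ih =>
      obtain ⟨L, rfl, hL⟩ := ih
      obtain ⟨k, hk⟩ := step L hL
      exact ⟨k :: L, rfl, hL, hk⟩
  have simple : ∀ j, ∃ k, IsSimpleCollision m (impact m (postState m x j)) k := by
    intro j
    obtain ⟨L, rfl, hL⟩ := all j
    exact step L hL
  choose σ hσ using simple
  refine ⟨σ, fun j => ?_⟩
  induction j with
  | zero => exact hx
  | succ j ih => exact ⟨ih, by rw [length_history]; exact hσ j⟩

/-! ### Bounds from the energy -/

theorem nonneg_of_gap_nonneg {u : Fin n → ℝ} (h : ∀ k, 0 ≤ gap u k) (i : Fin n) : 0 ≤ u i := by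
  obtain ⟨i, hi⟩ := i
  induction i with
  | zero => simpa [gap] using h ⟨0, hi⟩
  | succ i ih =>
    have h1 := h ⟨i + 1, hi⟩
    have h2 := ih (by omega)
    simp only [gap, below, Nat.add_sub_cancel, Nat.succ_ne_zero, if_false] at h1
    linarith

theorem single_energy_le (hm : ∀ i, 0 < m i) {y : Phase n} (hy : y ∈ phaseSpace n) (i : Fin n) :
    m i * (y.1 i + vel m y i ^ 2 / 2) ≤ energy m y := by
  rw [energy_eq hm]
  have := Finset.single_le_sum (f := fun i => m i * (1 * (y.1 i + vel m y i ^ 2 / 2)))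
    (fun i _ => by
      have := (hm i).le
      have := nonneg_of_gap_nonneg hy i
      positivity) (Finset.mem_univ i)
  simpa [weightedEnergy] using this

/-- Bounds of the positions and the velocities by the energy. -/
theorem exists_bound (hm : ∀ i, 0 < m i) (E : ℝ) : ∃ B : ℝ, ∀ y ∈ phaseSpace n, energy m y = E →
    ∀ i, 0 ≤ y.1 i ∧ y.1 i ≤ B ∧ |vel m y i| ≤ B := by
  -- The second summand turns a bound on `v²` into one on `|v|` by `s ≤ 1 + s²`; summing over the
  -- balls gives one constant for all.
  refine ⟨∑ i, (|E| / m i + (1 + 2 * |E| / m i)), fun y hy hE i => ?_⟩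
  have h0 := nonneg_of_gap_nonneg hy i
  have h1 := single_energy_le hm hy i
  have hi := hm i
  have h2 : |E| / m i + (1 + 2 * |E| / m i) ≤ ∑ i, (|E| / m i + (1 + 2 * |E| / m i)) :=
    Finset.single_le_sum (f := fun i => |E| / m i + (1 + 2 * |E| / m i))
      (fun i _ => by have := (hm i).le; positivity) (Finset.mem_univ i)
  have h3 : y.1 i + vel m y i ^ 2 / 2 ≤ |E| / m i := by
    rw [le_div_iff₀ hi]
    linarith [le_abs_self E]
  have h4 : 0 ≤ |E| / m i := by positivity
  have h5 : 2 * |E| / m i = 2 * (|E| / m i) := by ring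
  have h6 : |vel m y i| ^ 2 = vel m y i ^ 2 := sq_abs _
  refine ⟨h0, ?_, ?_⟩
  · nlinarith [sq_nonneg (vel m y i)]
  · nlinarith [sq_nonneg (|vel m y i| - 1), abs_nonneg (vel m y i)]

/-! ### Collision times do not accumulate -/

theorem collisionTime_mono (x : Phase n) : Monotone (collisionTime m x) :=
  monotone_nat_of_le_succ fun j => by
    rw [collisionTime]
    linarith [waitTime_nonneg (m := m) (postState m x j)]

/-- The orbit data of a point with simple collisions of the types `σ`. -/
theorem orbit_step (hm : ∀ i, 0 < m i) {x : Phase n} {σ : ℕ → Fin n}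
    (h : ∀ j, Follows m (history σ j) x) (j : ℕ) :
    postState m x j = fly m (collisionTime m x j) (virt m (history σ j) x) ∧
    Outgoing m (postState m x j) ∧
    impactVel m (σ j) (virt m (history σ j) x) < 0 ∧
    gap (postState m x (j + 1)).1 (σ j) = 0 ∧
    gap (vel m (postState m x (j + 1))) (σ j) = - impactVel m (σ j) (virt m (history σ j) x) ∧
    impactShift m (σ j) (virt m (history σ j) x) =
      - (collisionTime m x (j + 1) * impactVel m (σ j) (virt m (history σ j) x)) ∧
    postState m x (j + 1) = collisionMap m (σ j) (impact m (postState m x j)) := by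
  have hj := h j
  have hj1 : Follows m (σ j :: history σ j) x := h (j + 1)
  have hs := hj1.2
  have hp := hj1.postState_cons
  have hi := hj.impact_eq hm
  have h0 := hj.post hm
  rw [length_history] at hs hp hi h0
  refine ⟨h0.1, h0.2, hj1.impactVel_neg hm, ?_, ?_, ?_, hp⟩
  · rw [hp]; exact hs.1
  · rw [hp, vel_collisionMap hm, gap_reflect hm, hi]
    rw [hi] at hs
    rw [impactVel_eq hm hs.1 hs.2.1]
  · rw [hi] at hs
    exact impactShift_eq hm hs.1 hs.2.1

/-- Suppose the moments converge to `T`. The impulses are summable, so the virtual states converge,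
and in the limit every gap that is hit infinitely often is closed with zero relative velocity. If
the floor is hit infinitely often, the cluster of balls resting on it has conserved energy tending
to zero, yet its lowest ball leaves the floor with positive speed. Otherwise the limit velocity is
fixed by all late reflections, so the distance to it is conserved and tends to zero; the velocities
already equal the limit and no further collision is possible. -/
theorem tendsto_collisionTime (hm : ∀ i, 0 < m i) {x : Phase n} {σ : ℕ → Fin n}
    (h : ∀ j, Follows m (history σ j) x) : Tendsto (collisionTime m x) atTop atTop := by
  rcases tendsto_atTop_of_monotone (collisionTime_mono (m := m) x) with hT | ⟨T, hT⟩
  · exact hT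
  exfalso
  set X : ℕ → Phase n := fun j => virt m (history σ j) x with hX
  set y : ℕ → Phase n := postState m x with hy
  set g : ℕ → ℝ := fun j => impactVel m (σ j) (X j) with hg
  have orb := orbit_step hm h
  have hTle : ∀ j, collisionTime m x j ≤ T := (collisionTime_mono x).ge_of_tendsto hT
  have hT0 : ∀ j, 0 ≤ collisionTime m x j := fun j => collisionTime_mono x (Nat.zero_le j)
  obtain ⟨B, hB⟩ := exists_bound hm (energy m x)
  have hyB : ∀ j i, 0 ≤ (y j).1 i ∧ (y j).1 i ≤ B ∧ |vel m (y j) i| ≤ B := by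
    intro j
    refine hB _ (fun k => ((orb j).2.1 k).1) ?_
    have := (h j).energy_eq hm
    rwa [length_history] at this
  have hV : ∀ j i, vel m (X j) i = vel m (y j) i + collisionTime m x j := by
    intro j i
    have := congrArg (fun z => vel m z i) (orb j).1
    simp only [vel_fly hm] at this
    rw [hy, this]
    ring
  have hVB : ∀ j i, |vel m (X j) i| ≤ B + T := by
    intro j i
    rw [hV]
    refine (abs_add_le _ _).trans (add_le_add (hyB j i).2.2 ?_)
    rw [abs_of_nonneg (hT0 j)]
    exact hTle j
  have hVstep : ∀ j i, vel m (X (j + 1)) i = vel m (X j) i - g j * kick m (σ j) i := by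
    intro j i
    exact congrFun (vel_bypass hm (σ j) (X j)) i
  have hQstep : ∀ j i, (X (j + 1)).1 i =
      (X j).1 i + collisionTime m x (j + 1) * g j * kick m (σ j) i := by
    intro j i
    change (X j).1 i - impactShift m (σ j) (X j) * kick m (σ j) i = _
    rw [(orb j).2.2.2.2.2.1]
    ring
  have hgneg : ∀ j, g j < 0 := fun j => (orb j).2.2.1
  -- the total impulse is finite
  obtain ⟨ρ, hρ, hρle⟩ : ∃ ρ > 0, ∀ k, ρ ≤ redMass m k := by
    obtain ⟨k, -, hk⟩ := Finset.exists_min_image Finset.univ (redMass m) ⟨σ 0, Finset.mem_univ _⟩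
    exact ⟨_, redMass_pos hm k, fun l => hk l (Finset.mem_univ _)⟩
  -- The weights `i + 1` have gap 1 everywhere, including at the floor, so every collision raises
  -- this bounded sum by its impulse.
  set Φ : ℕ → ℝ := fun j => ∑ i : Fin n, m i * (((i : ℝ) + 1) * vel m (X j) i) with hΦ
  have hheight : ∀ k : Fin n, gap (fun i : Fin n => (i : ℝ) + 1) k = 1 := by
    intro k
    unfold gap
    split_ifs with hk
    · simp [hk]
    · simp only [below]
      rw [Nat.cast_sub (by omega)]
      push_cast
      ring
  have hΦstep : ∀ j, Φ (j + 1) = Φ j - g j * redMass m (σ j) := by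
    intro j
    have h1 := sum_mul_kick hm (fun i : Fin n => (i : ℝ) + 1) (σ j)
    rw [hheight, mul_one] at h1
    rw [hΦ, ← h1, Finset.mul_sum, ← Finset.sum_sub_distrib]
    refine Finset.sum_congr rfl fun i _ => ?_
    rw [hVstep]
    ring
  set M : ℝ := ∑ i : Fin n, m i * (((i : ℝ) + 1) * (B + T)) with hM
  have hΦB : ∀ j, |Φ j| ≤ M := by
    intro j
    refine (Finset.abs_sum_le_sum_abs _ _).trans (Finset.sum_le_sum fun i _ => ?_)
    have h1 := hm i
    have h2 : (0 : ℝ) ≤ (i : ℝ) + 1 := by positivity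
    rw [abs_mul, abs_mul, abs_of_pos h1, abs_of_nonneg h2]
    have := hVB j i
    gcongr
  have hgsum : Summable fun j => - g j := by
    refine summable_of_sum_range_le (c := 2 * M / ρ) (fun j => by linarith [hgneg j]) fun N => ?_
    have : ρ * ∑ j ∈ Finset.range N, - g j ≤ Φ N - Φ 0 := by
      rw [← Finset.sum_range_sub, Finset.mul_sum]
      refine Finset.sum_le_sum fun j _ => ?_
      rw [hΦstep]
      nlinarith [hgneg j, hρle (σ j)]
    rw [le_div_iff₀ hρ]
    linarith [abs_le.1 (hΦB N), abs_le.1 (hΦB 0)]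
  have hg0 : Tendsto g atTop (𝓝 0) := by
    simpa using hgsum.tendsto_atTop_zero.neg
  -- the virtual states converge
  set C : ℝ := ∑ k, ∑ i, |kick m k i| with hC
  have hkick : ∀ k i, |kick m k i| ≤ C := fun k i =>
    (Finset.single_le_sum (f := fun i => |kick m k i|) (fun _ _ => abs_nonneg _)
      (Finset.mem_univ i)).trans
    (Finset.single_le_sum (f := fun k => ∑ i, |kick m k i|)
      (fun _ _ => Finset.sum_nonneg fun _ _ => abs_nonneg _) (Finset.mem_univ k))
  have hVlim : ∀ i, ∃ V, Tendsto (fun j => vel m (X j) i) atTop (𝓝 V) := by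
    intro i
    refine cauchySeq_tendsto_of_complete (cauchySeq_of_dist_le_of_summable (fun j => - g j * C)
      (fun j => ?_) (hgsum.mul_right C))
    rw [Nat.succ_eq_add_one, hVstep, Real.dist_eq, sub_sub_cancel, abs_mul, abs_of_neg (hgneg j)]
    exact mul_le_mul_of_nonneg_left (hkick _ _) (by linarith [hgneg j])
  have hQlim : ∀ i, ∃ Q, Tendsto (fun j => (X j).1 i) atTop (𝓝 Q) := by
    intro i
    refine cauchySeq_tendsto_of_complete (cauchySeq_of_dist_le_of_summable
      (fun j => - g j * (T * C)) (fun j => ?_) (hgsum.mul_right (T * C)))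
    have e : (X j).1 i - (X j.succ).1 i =
        - g j * (collisionTime m x (j + 1) * kick m (σ j) i) := by
      rw [Nat.succ_eq_add_one, hQstep]
      ring
    have h1 : 0 ≤ - g j := by linarith [hgneg j]
    rw [Real.dist_eq, e, abs_mul, abs_of_nonneg h1, abs_mul, abs_of_nonneg (hT0 _)]
    exact mul_le_mul_of_nonneg_left (mul_le_mul (hTle _) (hkick _ _) (abs_nonneg _)
      ((hT0 0).trans (hTle 0))) h1
  choose V hVl using hVlim
  choose Q hQl using hQlim
  have hVt : Tendsto (fun j => vel m (X j)) atTop (𝓝 V) := tendsto_pi_nhds.2 hVl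
  obtain ⟨v, hv⟩ : ∃ v, Tendsto (fun j => vel m (y j)) atTop (𝓝 v) := by
    refine ⟨fun i => V i - T, tendsto_pi_nhds.2 fun i => ?_⟩
    refine ((hVl i).sub hT).congr fun j => ?_
    rw [hV]; ring
  obtain ⟨q, hq⟩ : ∃ q, Tendsto (fun j => (y j).1) atTop (𝓝 q) := by
    refine ⟨fun i => Q i + V i * T - T ^ 2 / 2, tendsto_pi_nhds.2 fun i => ?_⟩
    refine (((hQl i).add ((hVl i).mul hT)).sub ((hT.pow 2).div_const 2)).congr fun j => ?_
    rw [hy, (orb j).1]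
    simp only [fly, hX]
  -- the types which occur infinitely often
  have hoft : ∀ᶠ j in atTop, ∃ᶠ i in atTop, σ i = σ j := by
    have : ∀ᶠ j in atTop, ∀ k, (¬ ∃ᶠ i in atTop, σ i = k) → σ j ≠ k := by
      refine eventually_all.2 fun k => ?_
      by_cases hk : ∃ᶠ i in atTop, σ i = k
      · exact Eventually.of_forall fun _ h => absurd hk h
      · exact (not_frequently.1 hk).mono fun _ h _ => h
    filter_upwards [this] with j hj
    by_contra hc
    exact hj _ hc rfl
  have hgapq : ∀ k, (∃ᶠ i in atTop, σ i = k) → gap q k = 0 := by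
    intro k hk
    have h1 : Tendsto (fun j => gap (y (j + 1)).1 k) atTop (𝓝 (gap q k)) :=
      (((continuous_gap k).tendsto q).comp hq).comp (tendsto_add_atTop_nat 1)
    refine isClosed_singleton.mem_of_frequently_of_tendsto (hk.mono fun j hj => ?_) h1
    rw [← hj]
    exact (orb j).2.2.2.1
  have hgapv : ∀ k, (∃ᶠ i in atTop, σ i = k) → gap v k = 0 := by
    intro k hk
    have h1 : Tendsto (fun j => gap (vel m (y (j + 1))) k + g j) atTop (𝓝 (gap v k + 0)) :=
      ((((continuous_gap k).tendsto v).comp hv).comp (tendsto_add_atTop_nat 1)).add hg0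
    rw [add_zero] at h1
    refine isClosed_singleton.mem_of_frequently_of_tendsto (hk.mono fun j hj => ?_) h1
    rw [← hj, (orb j).2.2.2.2.1]
    simp [hg, hX]
  obtain ⟨J, hJ⟩ := eventually_atTop.1 hoft
  by_cases hfl : ∃ k : Fin n, k.1 = 0 ∧ ∃ᶠ i in atTop, σ i = k
  · -- the cluster at the floor loses its energy
    obtain ⟨k₀, hk₀, hk₀f⟩ := hfl
    classical
    -- The cluster consists of the balls joined to the floor by contacts that all recur. After `J`
    -- only recurring types occur, so no collision exchanges energy across the upper end of the
    -- cluster.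
    set χ : Fin n → ℝ := fun i => if ∀ k ≤ i, ∃ᶠ j in atTop, σ j = k then 1 else 0 with hχ
    have hχ0 : ∀ i, 0 ≤ χ i := fun i => by
      simp only [hχ]; split_ifs <;> norm_num
    have hχb : ∀ k, (∃ᶠ i in atTop, σ i = k) → k.1 ≠ 0 → χ (below k) = χ k := by
      intro k hk hk0
      have : (∀ l ≤ below k, ∃ᶠ j in atTop, σ j = l) ↔ (∀ l ≤ k, ∃ᶠ j in atTop, σ j = l) := by
        refine ⟨fun H l hl => ?_, fun H l hl => H l (hl.trans ?_)⟩
        · rcases hl.lt_or_eq with h | h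
          · refine H l (Fin.le_def.2 ?_)
            have := Fin.lt_def.1 h
            simp only [below]
            omega
          · rw [h]; exact hk
        · exact Fin.le_def.2 (by simp [below])
      simp only [hχ, this]
    have hlim0 : ∀ i : ℕ, ∀ hi : i < n, χ ⟨i, hi⟩ ≠ 0 → q ⟨i, hi⟩ = 0 ∧ v ⟨i, hi⟩ = 0 := by
      intro i
      induction i with
      | zero =>
        intro hi hχi
        have hf : ∃ᶠ j in atTop, σ j = ⟨0, hi⟩ := by
          by_contra hc
          exact hχi (if_neg fun H => hc (H _ le_rfl))
        have h1 := hgapq _ hf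
        have h2 := hgapv _ hf
        simpa [gap] using And.intro h1 h2
      | succ i ih =>
        intro hi hχi
        have hf : ∃ᶠ j in atTop, σ j = ⟨i + 1, hi⟩ := by
          by_contra hc
          exact hχi (if_neg fun H => hc (H _ le_rfl))
        have hb := hχb _ hf (Nat.succ_ne_zero i)
        have h1 := hgapq _ hf
        have h2 := hgapv _ hf
        obtain ⟨h3, h4⟩ := ih (by omega) (by
          have : below (⟨i + 1, hi⟩ : Fin n) = ⟨i, by omega⟩ := rfl
          rw [this] at hb
          rw [hb]; exact hχi)
        simp only [gap, below, Nat.add_sub_cancel, Nat.succ_ne_zero, if_false, h3, h4,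
          sub_zero] at h1 h2
        exact ⟨h1, h2⟩
    have hWstep : ∀ j, J ≤ j → weightedEnergy m χ (y j) = weightedEnergy m χ (y J) := by
      intro j hj
      induction j, hj using Nat.le_induction with
      | base => rfl
      | succ j hj ih =>
        rw [← ih, hy, (orb j).2.2.2.2.2.2,
          weightedEnergy_collisionMap hm χ _ (hχb _ (hJ j hj)), impact, weightedEnergy_fly hm]
    have hWlim : Tendsto (fun j => weightedEnergy m χ (y j)) atTop (𝓝 0) := by
      have h1 : Tendsto (fun j => weightedEnergy m χ (y j)) atTop
          (𝓝 (∑ i, m i * (χ i * (q i + v i ^ 2 / 2)))) := by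
        refine tendsto_finsetSum _ fun i _ => ?_
        exact ((((tendsto_pi_nhds.1 hq i).add
          (((tendsto_pi_nhds.1 hv i).pow 2).div_const 2)).const_mul (χ i)).const_mul (m i))
      rwa [Finset.sum_eq_zero] at h1
      intro i _
      by_cases hi : χ i = 0
      · rw [hi]; ring
      · obtain ⟨h3, h4⟩ := hlim0 i.1 i.2 hi
        simp [h3, h4]
    have hWJ : weightedEnergy m χ (y J) = 0 := by
      refine tendsto_nhds_unique (tendsto_const_nhds.congr' ?_) hWlim
      filter_upwards [eventually_ge_atTop J] with j hj
      exact (hWstep j hj).symm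
    obtain ⟨j, hjk, hj⟩ := (hk₀f.and_eventually (eventually_ge_atTop J)).exists
    have h1 := hWstep (j + 1) (by omega)
    rw [hWJ] at h1
    have h2 := (Finset.sum_eq_zero_iff_of_nonneg (fun i _ => mul_nonneg (hm i).le
      (mul_nonneg (hχ0 i) (add_nonneg (hyB (j + 1) i).1 (by positivity))))).1 h1 k₀
      (Finset.mem_univ _)
    have h3 : χ k₀ = 1 := by
      refine if_pos fun k hk => ?_
      have : k = k₀ := Fin.ext (by have := Fin.le_def.1 hk; omega)
      rwa [this]
    have h4 := (orb j).2.2.2.2.1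
    rw [hjk] at h4
    have h5 : vel m (y (j + 1)) k₀ > 0 := by
      have h6 : gap (vel m (postState m x (j + 1))) k₀ = vel m (y (j + 1)) k₀ := by
        simp [gap, hk₀, hy]
      rw [← h6, h4, ← hjk]
      linarith [hgneg j]
    rw [h3] at h2
    have h7 := hm k₀
    have h8 := (hyB (j + 1) k₀).1
    have : 0 < m k₀ * (1 * ((y (j + 1)).1 k₀ + vel m (y (j + 1)) k₀ ^ 2 / 2)) := by positivity
    exact this.ne' h2
  · -- without the floor, the distance of the velocities to their limit is invariant
    have hk1 : ∀ j, J ≤ j → (σ j).1 ≠ 0 := fun j hj h0 => hfl ⟨σ j, h0, hJ j hj⟩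
    have hgj : ∀ j, J ≤ j → g j = gap (vel m (X j)) (σ j) := fun j hj => by
      simp [hg, impactVel, hk1 j hj]
    have hgapV : ∀ j, J ≤ j → gap V (σ j) = 0 := by
      intro j hj
      have h1 := hgapv _ (hJ j hj)
      have h2 : V = fun i => v i + T := by
        funext i
        refine tendsto_nhds_unique (hVl i) (((tendsto_pi_nhds.1 hv i).add hT).congr fun j => ?_)
        rw [hV]
      rw [h2, gap_add v (fun _ => T), h1, gap_const]
      simp [floorInd, hk1 j hj]
    set F : ℕ → ℝ := fun j => ∑ i, m i * ((vel m (X j) i - V i) * (vel m (X j) i - V i)) with hF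
    have hFstep : ∀ j, J ≤ j → F j = F J := by
      intro j hj
      induction j, hj using Nat.le_induction with
      | base => rfl
      | succ j hj ih =>
        rw [← ih]
        have h1 := sum_sub_kick_mul hm (fun i => vel m (X j) i - V i)
          (fun i => vel m (X j) i - V i) (g j) (g j) (σ j)
        rw [gap_sub (vel m (X j)) V, hgapV j hj, ← hgj j hj] at h1
        have h2 : F j = ∑ i, m i * ((vel m (X j) i - V i) * (vel m (X j) i - V i)) := rfl
        have h3 : F (j + 1) = ∑ i, m i * ((vel m (X j) i - V i - g j * kick m (σ j) i) *
            (vel m (X j) i - V i - g j * kick m (σ j) i)) := by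
          refine Finset.sum_congr rfl fun i _ => ?_
          rw [hVstep]; ring
        rw [h3, h1, h2]
        ring
    have hFlim : Tendsto F atTop (𝓝 0) := by
      have h1 : Tendsto F atTop (𝓝 (∑ i, m i * ((V i - V i) * (V i - V i)))) := by
        refine tendsto_finsetSum _ fun i _ => ?_
        have h2 := (hVl i).sub_const (V i)
        exact (h2.mul h2).const_mul (m i)
      simpa using h1
    have hFJ : F J = 0 := by
      refine tendsto_nhds_unique (tendsto_const_nhds.congr' ?_) hFlim
      filter_upwards [eventually_ge_atTop J] with j hj
      exact (hFstep j hj).symm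
    have h2 := (Finset.sum_eq_zero_iff_of_nonneg (fun i _ => mul_nonneg (hm i).le
      (mul_self_nonneg _))).1 hFJ
    have h3 : vel m (X J) = V := by
      funext i
      have h4 := h2 i (Finset.mem_univ i)
      have h5 := mul_self_eq_zero.1 ((mul_eq_zero.1 h4).resolve_left (hm i).ne')
      linarith
    have h4 := hgneg J
    rw [hgj J le_rfl, h3, hgapV J le_rfl] at h4
    exact lt_irrefl _ h4

theorem nonsingular_of_follows (hm : ∀ i, 0 < m i) {x : Phase n} {σ : ℕ → Fin n}
    (h : ∀ j, Follows m (history σ j) x) : Nonsingular m x where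
  interior := h 0
  simple j := ⟨σ j, by
    have := (h (j + 1)).2
    rwa [length_history] at this⟩
  unbounded := tendsto_collisionTime hm h

/-! ### Local constancy of the itinerary -/

/-- The moment of the latest collision of a word. -/
def lastHit (m : Fin n → ℝ) : List (Fin n) → Phase n → ℝ
  | [], _ => 0
  | k :: L, x => hitTime m k (virt m L x)

theorem Follows.lastHit_eq (hm : ∀ i, 0 < m i) {x : Phase n} : ∀ {L : List (Fin n)},
    Follows m L x → lastHit m L x = collisionTime m x L.length
  | [], _ => rfl
  | _ :: _, h => h.hitTime_eq hm

theorem continuous_virt : ∀ L : List (Fin n), Continuous (virt m L)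
  | [] => continuous_id
  | k :: L => (continuous_bypass k).comp (continuous_virt L)

theorem Follows.continuousAt_lastHit (hm : ∀ i, 0 < m i) {x : Phase n} : ∀ {L : List (Fin n)},
    Follows m L x → ContinuousAt (lastHit m L) x
  | [], _ => continuousAt_const
  | k :: L, h => ContinuousAt.comp (f := virt m L) (g := hitTime m k)
      (continuousAt_hitTime (h.impactVel_neg hm).ne) (continuous_virt L).continuousAt

theorem isOpen_phaseInterior : IsOpen (phaseInterior n) := by
  have : phaseInterior n = ⋂ k, {x : Phase n | 0 < gap x.1 k} := by
    ext x; simp [phaseInterior]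
  rw [this]
  exact isOpen_iInter_of_finite fun k =>
    isOpen_lt continuous_const ((continuous_gap k).comp continuous_fst)

/-- Explicit hit times are continuous and the strict inequalities describing a simple collision are
open. `waitTime_eq` then identifies the hit time of a nearby point with its true waiting time from
the gaps at that single moment. -/
theorem Follows.eventually (hm : ∀ i, 0 < m i) (hn : 0 < n) {x : Phase n} :
    ∀ {L : List (Fin n)}, Follows m L x → ∀ᶠ x' in 𝓝 x, Follows m L x'
  | [], h => isOpen_phaseInterior.mem_nhds h
  | k :: L, h => by
    have hneg := h.impactVel_neg hm
    have hcL := h.1.continuousAt_lastHit hm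
    have hck := h.continuousAt_lastHit hm
    have hcv := (continuous_virt (m := m) L).continuousAt (x := x)
    have e1 : ∀ᶠ x' in 𝓝 x, impactVel m k (virt m L x') < 0 :=
      ((continuous_impactVel k).comp (continuous_virt L)).continuousAt.eventually
        (gt_mem_nhds hneg)
    have e2 : ∀ᶠ x' in 𝓝 x, lastHit m L x' < lastHit m (k :: L) x' := by
      refine hcL.eventually_lt hck ?_
      rw [h.1.lastHit_eq hm, h.lastHit_eq hm]
      change _ < collisionTime m x (L.length + 1)
      rw [collisionTime]
      linarith [waitTime_pos hn (h.1.post hm).2]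
    have e3 : ∀ᶠ x' in 𝓝 x, ∀ l, l ≠ k →
        0 < gap (fly m (lastHit m (k :: L) x') (virt m L x')).1 l := by
      refine eventually_all.2 fun l => ?_
      by_cases hl : l = k
      · exact Eventually.of_forall fun _ h => absurd hl h
      have hc : ContinuousAt (fun x' =>
          gap (fly m (lastHit m (k :: L) x') (virt m L x')).1 l) x :=
        (continuous_gap l).continuousAt.comp (continuous_fst.continuousAt.comp
          ((continuous_fly (m := m)).continuousAt.comp (hck.prodMk hcv)))
      refine (hc.eventually (lt_mem_nhds ?_)).mono fun _ h _ => h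
      have := h.2.2.2 l hl
      rwa [h.1.impact_eq hm, ← List.length_cons (a := k), ← h.lastHit_eq hm] at this
    filter_upwards [Follows.eventually hm hn h.1, e1, e2, e3] with x' h0 h1 h2 h3
    refine ⟨h0, ?_⟩
    obtain ⟨hp, ho⟩ := h0.post hm
    have hsum : fly m (lastHit m (k :: L) x' - lastHit m L x') (postState m x' L.length) =
        fly m (lastHit m (k :: L) x') (virt m L x') := by
      rw [hp, fly_fly hm, h0.lastHit_eq hm]
      congr 1
      ring
    have hgk : gap (fly m (lastHit m (k :: L) x') (virt m L x')).1 k = 0 := gap_fly_hitTime h1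
    have hw : waitTime m (postState m x' L.length) = lastHit m (k :: L) x' - lastHit m L x' := by
      refine waitTime_eq hn ho (by linarith) (fun l => ?_) (k := k) ?_
      · rw [hsum]
        by_cases hl : l = k
        · rw [hl, hgk]
        · exact (h3 l hl).le
      · rw [hsum, hgk]
    rw [impact, hw, hsum]
    refine ⟨hgk, ?_, h3⟩
    change gap (vel m (fly m (hitTime m k (virt m L x')) (virt m L x'))) k < 0
    rw [gap_vel_fly_hitTime hm h1]
    exact h1

theorem flow_eq_of_between {x : Phase n} {j : ℕ} {t : ℝ} (h1 : collisionTime m x j ≤ t)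
    (h2 : t < collisionTime m x (j + 1)) :
    flow m t x = fly m (t - collisionTime m x j) (postState m x j) := by
  have h : ∃ j, collisionTime m x j ≤ t ∧ t < collisionTime m x (j + 1) := ⟨j, h1, h2⟩
  have hmono := collisionTime_mono (m := m) x
  have hj : h.choose = j := by
    obtain ⟨h3, h4⟩ := h.choose_spec
    rcases lt_trichotomy h.choose j with hlt | heq | hgt
    · have : collisionTime m x (h.choose + 1) ≤ collisionTime m x j := hmono hlt
      linarith
    · exact heq
    · have : collisionTime m x (j + 1) ≤ collisionTime m x h.choose := hmono hgt
      linarith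
  rw [flow, dif_pos h, hj]

theorem Follows.flow_eq (hm : ∀ i, 0 < m i) {x : Phase n} {k : Fin n} {L : List (Fin n)}
    (h : Follows m (k :: L) x) {t : ℝ} (h1 : lastHit m L x < t) (h2 : t < lastHit m (k :: L) x) :
    flow m t x = fly m t (virt m L x) := by
  rw [h.1.lastHit_eq hm] at h1
  rw [h.lastHit_eq hm] at h2
  rw [flow_eq_of_between h1.le h2, (h.1.post hm).1, fly_fly hm]
  congr 1
  ring

/-- Equality near `x`, and not only at `x`, is what lets `fderiv` of the flow be computed from the
explicit maps. -/
theorem Follows.eventually_flow_eq (hm : ∀ i, 0 < m i) (hn : 0 < n) {x : Phase n} {k : Fin n}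
    {L : List (Fin n)} (h : Follows m (k :: L) x) {t : ℝ} (h1 : lastHit m L x < t)
    (h2 : t < lastHit m (k :: L) x) :
    flow m t =ᶠ[𝓝 x] fun x' => fly m t (virt m L x') := by
  filter_upwards [h.eventually hm hn, (h.1.continuousAt_lastHit hm).eventually (gt_mem_nhds h1),
    (h.continuousAt_lastHit hm).eventually (lt_mem_nhds h2)] with x' g0 g1 g2
  exact g0.flow_eq hm g1 g2

theorem Follows.flow_mem_interior (hm : ∀ i, 0 < m i) (hn : 0 < n) {x : Phase n} {k : Fin n}
    {L : List (Fin n)} (h : Follows m (k :: L) x) {t : ℝ} (h1 : lastHit m L x < t)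
    (h2 : t < lastHit m (k :: L) x) : flow m t x ∈ phaseInterior n := by
  rw [h.1.lastHit_eq hm] at h1
  rw [h.lastHit_eq hm, List.length_cons] at h2
  rw [flow_eq_of_between h1.le h2]
  rw [collisionTime] at h2
  exact fun l => gap_fly_pos hn (h.1.post hm).2 (by linarith) (by linarith) l

/-! ### Linearization -/

/-- The momentum-to-velocity map. -/
def velL (m : Fin n → ℝ) : (Fin n → ℝ) →L[ℝ] (Fin n → ℝ) :=
  LinearMap.toContinuousLinearMap
    { toFun := fun p i => p i / m i
      map_add' := fun p r => by funext i; simp [add_div]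
      map_smul' := fun a p => by funext i; simp [mul_div_assoc] }

theorem velL_apply (p : Fin n → ℝ) : velL m p = fun i => p i / m i := rfl

/-- The relative velocity of type `k` as a functional of the state. -/
def gapVelL (m : Fin n → ℝ) (k : Fin n) : Phase n →L[ℝ] ℝ :=
  (gapL k).comp ((velL m).comp (ContinuousLinearMap.snd ℝ _ _))

theorem gapVelL_apply (k : Fin n) (x : Phase n) : gapVelL m k x = gap (vel m x) k := rfl

/-- The gap of type `k` as a functional of the state. -/
def gapPosL (k : Fin n) : Phase n →L[ℝ] ℝ := (gapL k).comp (ContinuousLinearMap.fst ℝ _ _)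

theorem gapPosL_apply (k : Fin n) (x : Phase n) : gapPosL k x = gap x.1 k := rfl

theorem hasFDerivAt_impactVel {k : Fin n} {x : Phase n} (h : impactVel m k x ≠ 0) :
    HasFDerivAt (impactVel m k)
      (if k.1 = 0 then (impactVel m k x)⁻¹ • (gap (vel m x) k • gapVelL m k + gapPosL k)
        else gapVelL m k) x := by
  by_cases hk : k.1 = 0
  · have e : impactVel m k = fun x => -√(gapVelL m k x ^ 2 + 2 * gapPosL k x) := by
      funext y; simp [impactVel, hk, gapVelL_apply, gapPosL_apply]
    have h1 : gapVelL m k x ^ 2 + 2 * gapPosL k x ≠ 0 := by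
      intro h0
      apply h
      simp only [e, h0, Real.sqrt_zero, neg_zero]
    have h2 := (((((gapVelL m k).hasFDerivAt (x := x)).pow 2).add
      (((gapPosL k).hasFDerivAt (x := x)).const_mul 2)).sqrt h1).neg
    have h3 : impactVel m k x = -√(gapVelL m k x ^ 2 + 2 * gapPosL k x) := congrFun e x
    have h4 : √(gapVelL m k x ^ 2 + 2 * gapPosL k x) ≠ 0 := by
      intro h0; rw [h0, neg_zero] at h3; exact h h3
    rw [if_pos hk, h3, e]
    refine h2.congr_fderiv ?_
    ext ξ
    · simp [gapVelL_apply]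
      field_simp
      ring
    · simp [gapVelL_apply]
      field_simp
      ring
  · have e : impactVel m k = gapVelL m k := by
      funext y; simp [impactVel, hk, gapVelL_apply]
    rw [if_neg hk, e]
    exact (gapVelL m k).hasFDerivAt

theorem hasFDerivAt_impactShift {k : Fin n} {x : Phase n} (h : impactVel m k x ≠ 0) :
    ∃ A B : Phase n →L[ℝ] ℝ, HasFDerivAt (impactVel m k) A x ∧ HasFDerivAt (impactShift m k) B x ∧
      (∀ w, A (w, 0) = if k.1 = 0 then gap w k / impactVel m k x else 0) ∧
      ∀ w, B (w, 0) = if k.1 = 0 then 2 * gap w k - gap (vel m x) k * (gap w k / impactVel m k x)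
        else gap w k := by
  have hA := hasFDerivAt_impactVel h
  by_cases hk : k.1 = 0
  · rw [if_pos hk] at hA
    have e : impactShift m k = - (impactVel m k * (⇑(gapVelL m k) - impactVel m k)) := by
      funext y; simp [impactShift, hk, gapVelL_apply]
    have hw : ∀ w, gapVelL m k (w, 0) = 0 := fun w => by
      rw [gapVelL_apply]; simp [gap, vel]
    refine ⟨_, _, hA, e ▸ (hA.mul (((gapVelL m k).hasFDerivAt).sub hA)).neg,
      fun w => ?_, fun w => ?_⟩
    · simp [hk, hw, gapPosL_apply]
      field_simp
    · simp [hk, hw, gapPosL_apply, gapVelL_apply]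
      field_simp
      ring
  · rw [if_neg hk] at hA
    have e : impactShift m k = gapPosL k := by
      funext y; simp [impactShift, hk, gapPosL_apply]
    refine ⟨_, gapPosL k, hA, e ▸ (gapPosL k).hasFDerivAt, fun w => ?_, fun w => ?_⟩
    · rw [gapVelL_apply]; simp [gap, vel, hk]
    · simp [gapPosL_apply, hk]

/-- Only the images of vectors `(w, 0)` matter. Balls colliding with each other keep `δp = 0`; the
floor creates `δp` in proportion to the displacement of the lowest ball. -/
theorem hasFDerivAt_bypass {k : Fin n} {x : Phase n} (h : impactVel m k x ≠ 0) :
    ∃ D : Phase n →L[ℝ] Phase n, HasFDerivAt (bypass m k) D x ∧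
      ∀ w, D (w, 0) = if k.1 = 0 then
        (fun j => w j - (2 * gap w k - gap (vel m x) k * (gap w k / impactVel m k x)) * kick m k j,
          fun j => - (gap w k / impactVel m k x * (m j * kick m k j)))
        else (reflect m k w, 0) := by
  obtain ⟨A, B, hA, hB, hAw, hBw⟩ := hasFDerivAt_impactShift h
  have e : bypass m k = fun x => (x.1 - impactShift m k x • kick m k,
      x.2 - impactVel m k x • fun j => m j * kick m k j) := by
    funext y; rfl
  refine ⟨_, e ▸ ((hasFDerivAt_fst.sub (hB.smul_const (kick m k))).prodMk
    (hasFDerivAt_snd.sub (hA.smul_const fun j => m j * kick m k j))), fun w => ?_⟩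
  by_cases hk : k.1 = 0
  · simp only [hk, if_true] at hAw hBw ⊢
    refine Prod.ext (funext fun j => ?_) (funext fun j => ?_)
    · simp [hBw]
    · simp [hAw]
  · simp only [hk, if_false] at hAw hBw ⊢
    refine Prod.ext (funext fun j => ?_) (funext fun j => ?_)
    · simp [hBw, reflect]
    · simp [hAw]

/-- The transformation of neutral vectors by the collisions of a word. -/
def reflectWord (m : Fin n → ℝ) : List (Fin n) → (Fin n → ℝ) → (Fin n → ℝ)
  | [], w => w
  | k :: L, w => reflect m k (reflectWord m L w)

/-- The vectors `δq` with `∑ m_i δq_i = 0` for which the lowest ball is not displaced at its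
impacts with the floor. -/
def NeutralFor (m : Fin n → ℝ) : List (Fin n) → (Fin n → ℝ) → Prop
  | [], w => ∑ i, m i * w i = 0
  | k :: L, w => NeutralFor m L w ∧ (k.1 = 0 → gap (reflectWord m L w) k = 0)

theorem NeutralFor.sum_eq_zero (hm : ∀ i, 0 < m i) {w : Fin n → ℝ} : ∀ {L : List (Fin n)},
    NeutralFor m L w → ∑ i, m i * reflectWord m L w i = 0
  | [], h => h
  | k :: L, h => by
    have h1 := NeutralFor.sum_eq_zero hm h.1
    have h2 := sum_mul_kick hm (fun _ => 1) k
    simp only [gap_const, mul_one, one_mul] at h2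
    have : ∑ i, m i * reflectWord m (k :: L) w i = ∑ i, m i * reflectWord m L w i -
        gap (reflectWord m L w) k * ∑ i, m i * kick m k i := by
      rw [Finset.mul_sum, ← Finset.sum_sub_distrib]
      refine Finset.sum_congr rfl fun i _ => ?_
      simp only [reflectWord, reflect]
      ring
    rw [this, h1, h2]
    by_cases hk : k.1 = 0
    · rw [h.2 hk]; ring
    · simp [floorInd, hk]

theorem hasFDerivAt_virt {x : Phase n} {w : Fin n → ℝ} : ∀ {L : List (Fin n)},
    Regular m L x → NeutralFor m L w → ∃ D : Phase n →L[ℝ] Phase n,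
      HasFDerivAt (virt m L) D x ∧ D (w, 0) = (reflectWord m L w, 0)
  | [], _, _ => ⟨_, hasFDerivAt_id x, rfl⟩
  | k :: L, hr, hw => by
    obtain ⟨D, hD, hDw⟩ := hasFDerivAt_virt hr.1 hw.1
    obtain ⟨D', hD', hDw'⟩ := hasFDerivAt_bypass hr.2
    refine ⟨_, hD'.comp x hD, ?_⟩
    rw [ContinuousLinearMap.comp_apply, hDw, hDw']
    by_cases hk : k.1 = 0
    · rw [if_pos hk]
      have := hw.2 hk
      refine Prod.ext (funext fun j => ?_) (funext fun j => ?_)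
      · simp [this, reflectWord, reflect]
      · simp [this]
    · rw [if_neg hk]
      rfl

/-- The projection shifts all `δv_i` by one constant, which pairs to zero with `∑ δh_i = 0`. -/
theorem formQ_modFlow (hm : ∀ i, 0 < m i) {x ξ : Phase n} (h : ∑ i, dh m x ξ i = 0) :
    formQ m x (modFlow m x ξ) = formQ m x ξ := by
  set a := (∑ i, dv m ξ i) / n
  have h1 : ∀ i, dh m x (modFlow m x ξ) i = dh m x ξ i := fun i => by
    simp [dh, modFlow, field]
    ring
  have h2 : ∀ i, dv m (modFlow m x ξ) i = dv m ξ i - a := fun i => by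
    have := (hm i).ne'
    have h3 : (modFlow m x ξ).2 i = ξ.2 i + a * (- m i) := rfl
    simp only [dv, h3]
    field_simp
    ring
  simp only [formQ, h1, h2, mul_sub, Finset.sum_sub_distrib, ← Finset.sum_mul, h]
  ring

theorem hasFDerivAt_fly (t : ℝ) (x : Phase n) :
    ∃ D : Phase n →L[ℝ] Phase n, HasFDerivAt (fly m t) D x ∧
      ∀ ξ, D ξ = (fun i => ξ.1 i + ξ.2 i / m i * t, ξ.2) := by
  have e : fly m t = fun x => (x.1 + t • velL m x.2 - fun _ => t ^ 2 / 2,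
      x.2 - fun i => m i * t) := by
    funext y
    refine Prod.ext (funext fun i => ?_) (funext fun i => ?_)
    · simp [fly, vel, velL_apply]; ring
    · simp [fly]
  refine ⟨_, e ▸ (((hasFDerivAt_fst.add
    (((velL m).hasFDerivAt.comp x hasFDerivAt_snd).const_smul t)).sub_const _).prodMk
      (hasFDerivAt_snd.sub_const _)), fun ξ => ?_⟩
  refine Prod.ext (funext fun i => ?_) rfl
  simp [velL_apply]
  ring

theorem dh_fly (hm : ∀ i, 0 < m i) (t : ℝ) (x ξ : Phase n) (i : Fin n) :
    dh m (fly m t x) (fun i => ξ.1 i + ξ.2 i / m i * t, ξ.2) i = dh m x ξ i := by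
  have := (hm i).ne'
  simp only [dh, vel_fly hm]
  field_simp
  ring

/-- A vector `(δq, 0)` which displaces the lowest ball at an impact with the floor is not
neutral. -/
theorem formQ_floor (hm : ∀ i, 0 < m i) {k : Fin n} (hk : k.1 = 0) {x : Phase n}
    (h : impactVel m k x ≠ 0) {w : Fin n → ℝ} (hw : ∑ i, m i * w i = 0) {ξ : Phase n}
    (hξ : ξ = (fun j => w j -
        (2 * gap w k - gap (vel m x) k * (gap w k / impactVel m k x)) * kick m k j,
          fun j => - (gap w k / impactVel m k x * (m j * kick m k j)))) :
    ∑ i, dh m (bypass m k x) ξ i = 0 ∧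
      formQ m (bypass m k x) ξ = - (2 * m k * gap w k ^ 2 / impactVel m k x) := by
  have hkick : ∀ j, kick m k j = if j = k then 2 else 0 := by
    intro j
    have := (hm k).ne'
    by_cases hj : j = k
    · subst hj
      simp only [kick, redMass, contact, hk, if_true]
      field_simp
      norm_num
    · simp [kick, contact, hk, hj]
  have hg : gap w k = w k := by simp [gap, hk]
  have hgv : gap (vel m x) k = vel m x k := by simp [gap, hk]
  have hdv : ∀ i, dv m ξ i = if i = k then - (2 * (w k / impactVel m k x)) else 0 := by
    intro i
    have := (hm i).ne'
    subst hξ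
    simp only [dv, hkick, hg]
    split_ifs
    · field_simp
    · simp
  have hdh : ∀ i, dh m (bypass m k x) ξ i = m i * w i := by
    intro i
    subst hξ
    simp only [dh, vel_bypass hm, hkick, hg, hgv]
    split_ifs with hi
    · subst hi
      field_simp
      ring
    · simp
  refine ⟨by simp only [hdh, hw], ?_⟩
  simp only [formQ, hdh, hdv, mul_ite, mul_zero, Finset.sum_ite_eq', Finset.mem_univ, if_true, hg]
  ring

/-- The form is evaluated at a moment between the collision `k` and the next one `l`, where it keeps
its value from just after `k`. At the floor that value is a nonzero multiple of the squared
displacement of the lowest ball. The extra collision `l` serves only to bound this interval. -/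
theorem mem_neutralSpace_step (hm : ∀ i, 0 < m i) (hn : 0 < n) {x : Phase n} {w : Fin n → ℝ}
    (hw : ((w, 0) : Phase n) ∈ neutralSpace m x) {k l : Fin n} {L : List (Fin n)}
    (h : Follows m (l :: k :: L) x) (hL : NeutralFor m L w) : NeutralFor m (k :: L) w := by
  refine ⟨hL, fun hk => ?_⟩
  have hreg := h.1.regular hm
  obtain ⟨D, hD, hDw⟩ := hasFDerivAt_virt hreg.1 hL
  obtain ⟨D', hD', hDw'⟩ := hasFDerivAt_bypass hreg.2
  have hlt : lastHit m (k :: L) x < lastHit m (l :: k :: L) x := by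
    rw [h.1.lastHit_eq hm, h.lastHit_eq hm, List.length_cons (a := l), collisionTime]
    linarith [waitTime_pos hn (h.1.post hm).2]
  obtain ⟨t, ht1, ht2⟩ := exists_between hlt
  have ht0 : 0 ≤ t := by
    rw [h.1.lastHit_eq hm] at ht1
    have : collisionTime m x 0 ≤ collisionTime m x (k :: L).length :=
      collisionTime_mono x (Nat.zero_le _)
    rw [collisionTime] at this
    linarith
  have hQ := hw.2.2 t ht0 (h.flow_mem_interior hm hn ht1 ht2)
  obtain ⟨D'', hD'', hDw''⟩ := hasFDerivAt_fly (m := m) t (bypass m k (virt m L x))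
  have hvirt : HasFDerivAt (virt m (k :: L)) (D'.comp D) x := HasFDerivAt.comp x hD' hD
  have hcomp : HasFDerivAt (fun x' => fly m t (virt m (k :: L) x')) (D''.comp (D'.comp D)) x :=
    HasFDerivAt.comp (g := fly m t) x hD'' hvirt
  have hfd := hcomp.congr_of_eventuallyEq (h.eventually_flow_eq hm hn ht1 ht2)
  have hflow : flow m t x = fly m t (bypass m k (virt m L x)) := h.flow_eq hm ht1 ht2
  have hξ := hDw' (reflectWord m L w)
  rw [if_pos hk] at hξ
  obtain ⟨h1, h2⟩ := formQ_floor hm hk hreg.2 (hL.sum_eq_zero hm) hξ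
  rw [dFlow, hfd.fderiv, ContinuousLinearMap.comp_apply, ContinuousLinearMap.comp_apply, hDw,
    hDw'', hflow] at hQ
  generalize D' (reflectWord m L w, 0) = ξ at h1 h2 hQ
  rw [formQ_modFlow hm (by simpa only [dh_fly hm] using h1)] at hQ
  have h5 : formQ m (fly m t (bypass m k (virt m L x))) (fun i => ξ.1 i + ξ.2 i / m i * t, ξ.2) =
      formQ m (bypass m k (virt m L x)) ξ :=
    Finset.sum_congr rfl fun i _ => by rw [dh_fly hm]; rfl
  rw [h5, h2] at hQ
  have h3 := hm k
  have h4 := hreg.2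
  field_simp at hQ
  simpa [h3.ne'] using hQ

theorem neutralFor_of_mem (hm : ∀ i, 0 < m i) (hn : 0 < n) {x : Phase n} {σ : ℕ → Fin n}
    (h : ∀ j, Follows m (history σ j) x) {w : Fin n → ℝ}
    (hw : ((w, 0) : Phase n) ∈ neutralSpace m x) (j : ℕ) : NeutralFor m (history σ j) w := by
  induction j with
  | zero =>
    have := hw.1.1
    simpa [dh, history, NeutralFor] using this
  | succ j ih => exact mem_neutralSpace_step hm hn hw (h (j + 2)) ih

/-! ### The conserved quantity of a neutral vector -/

/-- In a collision of two balls both factors undergo the same orthogonal reflection. At the floor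
the neutral vector has zero component along the kick, so the amount `b` is arbitrary. -/
theorem NeutralFor.sum_mul_step {w : Fin n → ℝ} {k : Fin n} {L : List (Fin n)} (hm : ∀ i, 0 < m i)
    (h : NeutralFor m (k :: L) w) (u : Fin n → ℝ) {b : ℝ} (hb : k.1 ≠ 0 → b = gap u k) :
    ∑ i, m i * (reflectWord m (k :: L) w i * (u i - b * kick m k i)) =
      ∑ i, m i * (reflectWord m L w i * u i) := by
  have h1 := sum_sub_kick_mul hm (reflectWord m L w) u (gap (reflectWord m L w) k) b k
  refine h1.trans ?_
  by_cases hk : k.1 = 0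
  · rw [h.2 hk]; ring
  · rw [hb hk]; ring

theorem NeutralFor.sum_mul_pos (hm : ∀ i, 0 < m i) {w : Fin n → ℝ} (x : Phase n) :
    ∀ {L : List (Fin n)}, NeutralFor m L w →
    ∑ i, m i * (reflectWord m L w i * (virt m L x).1 i) = ∑ i, m i * (w i * x.1 i)
  | [], _ => rfl
  | k :: L, h => by
    rw [← NeutralFor.sum_mul_pos hm x h.1]
    exact h.sum_mul_step hm (virt m L x).1 fun hk => by simp [impactShift, hk]

theorem NeutralFor.sum_mul_vel (hm : ∀ i, 0 < m i) {w : Fin n → ℝ} (x : Phase n) :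
    ∀ {L : List (Fin n)}, NeutralFor m L w →
    ∑ i, m i * (reflectWord m L w i * vel m (virt m L x) i) = ∑ i, m i * (w i * vel m x i)
  | [], _ => rfl
  | k :: L, h => by
    rw [← NeutralFor.sum_mul_vel hm x h.1, virt, vel_bypass hm]
    exact h.sum_mul_step hm (vel m (virt m L x)) fun hk => by simp [impactVel, hk]

theorem sum_reflectWord_sq (hm : ∀ i, 0 < m i) (w : Fin n → ℝ) : ∀ L : List (Fin n),
    ∑ i, m i * (reflectWord m L w i * reflectWord m L w i) = ∑ i, m i * (w i * w i)
  | [] => rfl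
  | k :: L => by
    rw [← sum_reflectWord_sq hm w L]
    exact sum_reflect_mul hm _ _ k

/-- Along a neutral vector the linear momentum vanishes, since otherwise the positions would
grow linearly in time. -/
theorem sum_mul_vel_eq_zero (hm : ∀ i, 0 < m i) {x : Phase n} {σ : ℕ → Fin n}
    (h : ∀ j, Follows m (history σ j) x) {w : Fin n → ℝ}
    (hw : ∀ j, NeutralFor m (history σ j) w) : ∑ i, m i * (w i * vel m x i) = 0 := by
  set T := collisionTime m x
  set V := ∑ i, m i * (w i * vel m x i)
  set K := ∑ i, m i * (w i * x.1 i)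
  obtain ⟨B, hB⟩ := exists_bound hm (energy m x)
  -- The bound comes from `|r q| ≤ r² + B²`; the mass norm of the transported vector `r` equals that
  -- of `w`.
  set M := ∑ i, m i * (w i * w i) + ∑ i, m i * (B * B)
  have hlin : ∀ j, |K + T j * V| ≤ M := by
    intro j
    obtain ⟨h1, h2, -⟩ := orbit_step hm h j
    have hE := (h j).energy_eq hm
    rw [length_history] at hE
    have hb := hB _ (fun k => (h2 k).1) hE
    set r := reflectWord m (history σ j) w
    have e : K + T j * V = ∑ i, m i * (r i * (postState m x j).1 i) := by
      have e1 : ∑ i, m i * (r i * (postState m x j).1 i) =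
          ∑ i, m i * (r i * (virt m (history σ j) x).1 i) +
          T j * ∑ i, m i * (r i * vel m (virt m (history σ j) x) i) -
          T j ^ 2 / 2 * ∑ i, m i * r i := by
        rw [h1, Finset.mul_sum, Finset.mul_sum, ← Finset.sum_add_distrib,
          ← Finset.sum_sub_distrib]
        refine Finset.sum_congr rfl fun i _ => ?_
        simp only [fly]
        ring
      -- The quadratic term due to gravity drops out because the transported vector still satisfies
      -- `∑ m_i r_i = 0`.
      rw [e1, (hw j).sum_mul_pos hm, (hw j).sum_mul_vel hm, (hw j).sum_eq_zero hm]
      ring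
    rw [e]
    refine (Finset.abs_sum_le_sum_abs _ _).trans ?_
    have e2 : M = ∑ i, m i * (r i * r i + B * B) := by
      simp only [mul_add, Finset.sum_add_distrib, M, r, sum_reflectWord_sq hm]
    rw [e2]
    refine Finset.sum_le_sum fun i _ => ?_
    have hi := hm i
    obtain ⟨b1, b2, -⟩ := hb i
    rw [abs_mul, abs_of_pos hi]
    refine mul_le_mul_of_nonneg_left ?_ hi.le
    rw [abs_mul, abs_of_nonneg b1]
    have := abs_mul_abs_self (r i)
    nlinarith [sq_nonneg (|r i| - B), abs_nonneg (r i), mul_nonneg (abs_nonneg (r i)) (sub_nonneg.2 b2),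
      mul_self_nonneg (r i), mul_self_nonneg B]
  by_contra hV
  have hT : Tendsto (fun j => T j * |V|) atTop atTop :=
    (tendsto_collisionTime hm h).atTop_mul_const (abs_pos.2 hV)
  obtain ⟨j, hj⟩ := (hT.eventually_gt_atTop (M + |K|)).exists
  have h1 := hlin j
  have h2 : |T j * V| ≤ |K + T j * V| + |K| := by
    have := abs_sub (K + T j * V) K
    rwa [add_sub_cancel_left] at this
  have h3 : 0 ≤ T j := collisionTime_mono x (Nat.zero_le j)
  rw [abs_mul, abs_of_nonneg h3] at h2
  linarith

/-! ### Reduction to countably many test vectors -/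

theorem reflect_add (k : Fin n) (u w : Fin n → ℝ) :
    reflect m k (u + w) = reflect m k u + reflect m k w := by
  funext j
  have := gap_add u w k
  simp only [reflect, Pi.add_apply, show gap (u + w) k = gap u k + gap w k from this]
  ring

theorem reflect_smul (k : Fin n) (a : ℝ) (u : Fin n → ℝ) :
    reflect m k (a • u) = a • reflect m k u := by
  funext j
  have := gap_const_mul a u k
  simp only [reflect, Pi.smul_apply, smul_eq_mul, show gap (a • u) k = a * gap u k from this]
  ring

/-- `reflectWord` as a linear map. -/
def reflectWordL (m : Fin n → ℝ) (L : List (Fin n)) : (Fin n → ℝ) →ₗ[ℝ] (Fin n → ℝ) where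
  toFun := reflectWord m L
  map_add' u w := by
    induction L with
    | nil => rfl
    | cons k L ih => simp only [reflectWord, ih, reflect_add]
  map_smul' a u := by
    induction L with
    | nil => rfl
    | cons k L ih => simp only [reflectWord, ih, reflect_smul, RingHom.id_apply]

/-- The vectors that are neutral for a word. -/
def neutralSub (m : Fin n → ℝ) : List (Fin n) → Submodule ℝ (Fin n → ℝ)
  | [] => LinearMap.ker (∑ i, m i • LinearMap.proj (R := ℝ) (φ := fun _ : Fin n => ℝ) i)
  | k :: L => neutralSub m L ⊓ if k.1 = 0 then
      LinearMap.ker ((gapL k).toLinearMap ∘ₗ reflectWordL m L) else ⊤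

theorem mem_neutralSub {w : Fin n → ℝ} : ∀ {L : List (Fin n)},
    w ∈ neutralSub m L ↔ NeutralFor m L w
  | [] => by simp [neutralSub, NeutralFor]
  | k :: L => by
    rw [neutralSub, Submodule.mem_inf, mem_neutralSub, NeutralFor]
    refine and_congr_right fun _ => ?_
    by_cases hk : k.1 = 0
    · simp [hk, reflectWordL]
    · simp [hk]

open Classical in
/-- A nonzero vector that is neutral for a word, if there is one. -/
def testVector (m : Fin n → ℝ) (L : List (Fin n)) : Fin n → ℝ :=
  if h : ∃ w, w ≠ 0 ∧ NeutralFor m L w then h.choose else 0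

/-- The vector `w` depends on the point, but the neutral spaces along its itinerary decrease in
finite dimension and stabilize at some finite word. Any vector neutral for that word is then neutral
forever, in particular the one chosen from the word alone. -/
theorem exists_testVector (σ : ℕ → Fin n) {w : Fin n → ℝ} (hw0 : w ≠ 0)
    (hw : ∀ j, NeutralFor m (history σ j) w) :
    ∃ L, testVector m L ≠ 0 ∧ ∀ j, NeutralFor m (history σ j) (testVector m L) := by
  have hanti : Antitone fun j => neutralSub m (history σ j) :=
    antitone_nat_of_succ_le fun j => inf_le_left
  obtain ⟨J, hJ⟩ := IsArtinian.monotone_stabilizes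
    (⟨fun j => OrderDual.toDual (neutralSub m (history σ j)), hanti⟩ :
      ℕ →o (Submodule ℝ (Fin n → ℝ))ᵒᵈ)
  have hex : ∃ w, w ≠ 0 ∧ NeutralFor m (history σ J) w := ⟨w, hw0, hw J⟩
  have ht : testVector m (history σ J) = hex.choose := dif_pos hex
  refine ⟨history σ J, ht ▸ hex.choose_spec.1, fun j => ?_⟩
  have h1 : testVector m (history σ J) ∈ neutralSub m (history σ J) :=
    mem_neutralSub.2 (ht ▸ hex.choose_spec.2)
  rw [← mem_neutralSub]
  rcases le_total J j with hj | hj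
  · have h2 : neutralSub m (history σ J) = neutralSub m (history σ j) := hJ j hj
    rwa [← h2]
  · exact hanti hj h1

/-! ### The exceptional set -/

/-- The states whose orbit may be singular or have a neutral vector. -/
def exceptional (m : Fin n → ℝ) : Set (Phase n) :=
  (⋃ k : Fin n, {x | gap x.1 k = 0}) ∪
    ((⋃ L : List (Fin n), {x | Regular m L x ∧ virt m L x ∈ doubleContact m}) ∪
      ⋃ L : List (Fin n), {x | testVector m L ≠ 0 ∧
        ∑ i, m i * (testVector m L i * vel m x i) = 0})

theorem of_notMem_exceptional (hm : ∀ i, 0 < m i) (hn : 0 < n) {x : Phase n}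
    (hx : x ∈ energySurface m) (hex : x ∉ exceptional m) :
    Nonsingular m x ∧ neutralSpace m x = {0} := by
  simp only [exceptional, Set.mem_union, Set.mem_iUnion, not_or, not_exists] at hex
  obtain ⟨h1, h2, h3⟩ := hex
  have hint : x ∈ phaseInterior n := fun k => lt_of_le_of_ne (hx.1 k) (Ne.symm (h1 k))
  obtain ⟨σ, hσ⟩ := exists_follows hm hn hint fun L hL hd => h2 L ⟨hL, hd⟩
  refine ⟨nonsingular_of_follows hm hσ, Set.eq_singleton_iff_unique_mem.2 ⟨?_, ?_⟩⟩
  · refine ⟨Submodule.zero_mem _, fun i => by simp [dv], fun t _ _ => ?_⟩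
    simp [dFlow, modFlow, formQ, dv]
  · intro ξ hξ
    have hξ2 : ξ.2 = 0 := by
      funext i
      have h4 := hξ.2.1 i
      have h5 := (hm i).ne'
      simpa [dv, h5] using h4
    have hξe : ξ = (ξ.1, 0) := Prod.ext rfl hξ2
    rw [hξe] at hξ ⊢
    by_contra hne
    have hw0 : ξ.1 ≠ 0 := fun h => hne (by rw [h]; rfl)
    obtain ⟨L, hL0, hL⟩ := exists_testVector σ hw0 (neutralFor_of_mem hm hn hσ hξ)
    exact h3 L ⟨hL0, sum_mul_vel_eq_zero hm hσ hL⟩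

/-! ### Measurability and measure of the exceptional set -/

instance : (volume : Measure (Phase n)).IsAddHaarMeasure :=
  Measure.prod.instIsAddHaarMeasure (volume : Measure (Fin n → ℝ)) (volume : Measure (Fin n → ℝ))

theorem volume_ker_eq_zero {A : Phase n →L[ℝ] ℝ} (hA : A ≠ 0) :
    volume {x : Phase n | A x = 0} = 0 := by
  have h : LinearMap.ker A.toLinearMap ≠ ⊤ := by
    intro h
    apply hA
    refine ContinuousLinearMap.ext fun x => ?_
    have : x ∈ LinearMap.ker A.toLinearMap := h ▸ Submodule.mem_top
    exact this
  exact Measure.addHaar_submodule volume _ h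

/-- The configuration in which only the gap of type `k` is open. -/
def stepVec (k : Fin n) : Fin n → ℝ := fun i => if k ≤ i then 1 else 0

theorem gap_stepVec (k l : Fin n) : gap (stepVec k) l = if l = k then 1 else 0 := by
  unfold gap stepVec
  simp only [below, Fin.le_def, Fin.ext_iff]
  by_cases h0 : l.1 = 0
  · by_cases h1 : l.1 = k.1
    · simp [h0, ← h1]
    · have h2 : ¬ (k.1 = 0) := by omega
      have h3 : ¬ (0 = k.1) := by omega
      simp [h0, h2, h3]
  · rcases lt_trichotomy l.1 k.1 with h | h | h
    · have h1 : ¬ (k.1 ≤ l.1) := by omega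
      have h2 : ¬ (k.1 ≤ l.1 - 1) := by omega
      simp [h1, h2, h.ne]
    · have h2 : ¬ (k.1 ≤ l.1 - 1) := by omega
      rw [if_neg h0, if_neg h2, if_pos h.ge, if_pos h, sub_zero]
    · have h1 : k.1 ≤ l.1 := by omega
      have h2 : k.1 ≤ l.1 - 1 := by omega
      simp [h0, h1, h2, h.ne']

theorem gapPosL_ne_zero (k : Fin n) : gapPosL k ≠ (0 : Phase n →L[ℝ] ℝ) := by
  intro h
  have h1 : gapPosL k ((stepVec k, 0) : Phase n) = 0 := by rw [h]; rfl
  rw [gapPosL_apply, gap_stepVec] at h1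
  simp at h1

@[fun_prop]
theorem differentiable_fly : Differentiable ℝ fun z : ℝ × Phase n => fly m z.1 z.2 := by
  have e : (fun z : ℝ × Phase n => fly m z.1 z.2) = fun z : ℝ × Phase n =>
      (z.2.1 + z.1 • velL m z.2.2 - (fun _ => z.1 ^ 2 / 2), z.2.2 - z.1 • m) := by
    funext z
    refine Prod.ext (funext fun i => ?_) (funext fun i => ?_)
    · simp [fly, vel, velL_apply]; ring
    · simp [fly]; ring
  rw [e]
  fun_prop

/-- Two closed gaps cost two dimensions and the time of fall restores one. The gap `l`, being zero
at the contact, is free to carry the time, so the set lies in the image of a hyperplane under a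
differentiable self-map of phase space. -/
theorem volume_doubleContact (hm : ∀ i, 0 < m i) : volume (doubleContact (n := n) m) = 0 := by
  have e : doubleContact m = ⋃ k : Fin n, ⋃ l : Fin n, {x : Phase n | k ≠ l ∧
      ∃ t, gap (fly m t x).1 k = 0 ∧ gap (fly m t x).1 l = 0} := by
    ext x; simp [doubleContact]
  rw [e]
  refine measure_iUnion_null fun k => measure_iUnion_null fun l => ?_
  by_cases hkl : k = l
  · simp [hkl]
  set Ψ : Phase n → Phase n := fun y =>
    fly m (gapPosL l y) (y - gapPosL l y • ((stepVec l, 0) : Phase n)) with hΨ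
  have hd : Differentiable ℝ Ψ := by
    have h1 : Differentiable ℝ fun y : Phase n =>
        (gapPosL l y, y - gapPosL l y • ((stepVec l, 0) : Phase n)) := by
      fun_prop
    exact (differentiable_fly (m := m)).comp h1
  refine measure_mono_null ?_ (addHaar_image_eq_zero_of_differentiableOn_of_addHaar_eq_zero volume
    (s := {y | gapPosL k y = 0}) hd.differentiableOn (volume_ker_eq_zero (gapPosL_ne_zero k)))
  rintro x ⟨-, t, hk, hl⟩
  -- The gap `l` stores `-t`; `Ψ` reads it, closes the gap again and falls back to `x`.
  refine ⟨fly m t x + (-t) • ((stepVec l, 0) : Phase n), ?_, ?_⟩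
  · change gapPosL k _ = 0
    rw [map_add, map_smul, gapPosL_apply, gapPosL_apply, hk, gap_stepVec, if_neg hkl]
    simp
  · have h1 : gapPosL l (fly m t x + (-t) • ((stepVec l, 0) : Phase n)) = -t := by
      rw [map_add, map_smul, gapPosL_apply, gapPosL_apply, hl, gap_stepVec, if_pos rfl]
      simp
    simp only [hΨ, h1, add_sub_cancel_right]
    rw [fly_fly hm, add_neg_cancel, fly_zero]

/-- For each pair the set is the projection of a closed set, which is σ-compact, and σ-compactness
passes to the image. -/
theorem measurableSet_doubleContact : MeasurableSet (doubleContact (n := n) m) := by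
  have e : doubleContact m = ⋃ k : Fin n, ⋃ l : Fin n, ⋃ _ : k ≠ l, Prod.snd ''
      {z : ℝ × Phase n | gap (fly m z.1 z.2).1 k = 0 ∧ gap (fly m z.1 z.2).1 l = 0} := by
    ext x
    simp [doubleContact]
  rw [e]
  refine MeasurableSet.iUnion fun k => MeasurableSet.iUnion fun l => MeasurableSet.iUnion fun _ => ?_
  have hc : ∀ k : Fin n, Continuous fun z : ℝ × Phase n => gap (fly m z.1 z.2).1 k := fun k =>
    (continuous_gap k).comp (continuous_fst.comp continuous_fly)
  have h1 : IsClosed {z : ℝ × Phase n | gap (fly m z.1 z.2).1 k = 0 ∧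
      gap (fly m z.1 z.2).1 l = 0} :=
    (isClosed_eq (hc k) continuous_const).inter (isClosed_eq (hc l) continuous_const)
  obtain ⟨K, hK, hKU⟩ :=
    (isSigmaCompact_univ.of_isClosed_subset h1 (Set.subset_univ _)).image continuous_snd
  rw [← hKU]
  exact MeasurableSet.iUnion fun i => (hK i).measurableSet

theorem measurableSet_regular : ∀ L : List (Fin n), MeasurableSet {x : Phase n | Regular m L x}
  | [] => MeasurableSet.univ
  | k :: L => (measurableSet_regular L).inter
      (isOpen_ne_fun ((continuous_impactVel k).comp (continuous_virt L))
        continuous_const).measurableSet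

theorem measurableSet_exceptional : MeasurableSet (exceptional (n := n) m) := by
  refine (MeasurableSet.iUnion fun k => ?_).union
    ((MeasurableSet.iUnion fun L => ?_).union (MeasurableSet.iUnion fun L => ?_))
  · exact (isClosed_eq ((continuous_gap k).comp continuous_fst) continuous_const).measurableSet
  · exact (measurableSet_regular L).inter
      ((continuous_virt L).measurable measurableSet_doubleContact)
  · refine (MeasurableSet.const (testVector m L ≠ 0)).inter (IsClosed.measurableSet ?_)
    refine isClosed_eq ?_ continuous_const
    unfold vel
    fun_prop

/-- The reversal of the velocities. -/
def reversal (x : Phase n) : Phase n := (x.1, -x.2)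

theorem vel_reversal (x : Phase n) : vel m (reversal x) = fun i => - vel m x i := by
  funext i
  simp [vel, reversal, neg_div]

/-- After time reversal the same impact is met at the opposite moment with the same approach
velocity, so the product of the two changes sign. Hence conjugating by reversal inverts `bypass`. -/
theorem impactVel_reversal_bypass (hm : ∀ i, 0 < m i) (k : Fin n) {x : Phase n}
    (h : impactVel m k x ≠ 0) :
    impactVel m k (reversal (bypass m k x)) = impactVel m k x ∧
      impactShift m k (reversal (bypass m k x)) = - impactShift m k x := by
  have h1 : gap (vel m (reversal (bypass m k x))) k =
      2 * impactVel m k x - gap (vel m x) k := by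
    rw [vel_reversal, gap_neg, vel_bypass hm, gap_sub_kick hm]
    ring
  have h2 : gap (reversal (bypass m k x)).1 k = gap x.1 k - 2 * impactShift m k x :=
    gap_sub_kick hm _ _ _
  by_cases hk : k.1 = 0
  · have h3 : impactVel m k x = -√(gap (vel m x) k ^ 2 + 2 * gap x.1 k) := by
      simp [impactVel, hk]
    have h4 : impactShift m k x = - (impactVel m k x * (gap (vel m x) k - impactVel m k x)) := by
      simp [impactShift, hk]
    have h5 : impactVel m k x ^ 2 = gap (vel m x) k ^ 2 + 2 * gap x.1 k := by
      rw [h3, neg_sq, Real.sq_sqrt]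
      refine (Real.sqrt_ne_zero'.1 fun h0 => h ?_).le
      rw [h3, h0, neg_zero]
    have h6 : impactVel m k (reversal (bypass m k x)) = impactVel m k x := by
      rw [impactVel, if_pos hk, h1, h2, h4]
      rw [show (2 * impactVel m k x - gap (vel m x) k) ^ 2 +
        2 * (gap x.1 k - 2 * -(impactVel m k x * (gap (vel m x) k - impactVel m k x))) =
        gap (vel m x) k ^ 2 + 2 * gap x.1 k by ring, ← h3]
    refine ⟨h6, ?_⟩
    rw [impactShift, if_pos hk, h6, h1, h4]
    ring
  · have h3 : impactVel m k x = gap (vel m x) k := by simp [impactVel, hk]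
    have h4 : impactShift m k x = gap x.1 k := by simp [impactShift, hk]
    constructor
    · rw [impactVel, if_neg hk, h1, h3]; ring
    · rw [impactShift, if_neg hk, h2, h4]; ring

theorem reversal_bypass_reversal (hm : ∀ i, 0 < m i) (k : Fin n) {x : Phase n}
    (h : impactVel m k x ≠ 0) : reversal (bypass m k (reversal (bypass m k x))) = x := by
  obtain ⟨h1, h2⟩ := impactVel_reversal_bypass hm k h
  refine Prod.ext (funext fun i => ?_) (funext fun i => ?_)
  · simp only [reversal] at h1 h2 ⊢
    simp only [bypass] at h1 h2 ⊢
    rw [h2]; ring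
  · simp only [reversal] at h1 h2 ⊢
    simp only [bypass, Pi.neg_apply] at h1 h2 ⊢
    rw [h1]; ring

/-- The preimage is contained in the image of a part of `Z` under the inverse `reversal ∘ bypass ∘
reversal`, which is differentiable there and so preserves null sets. -/
theorem volume_preimage_bypass (hm : ∀ i, 0 < m i) (k : Fin n) {Z : Set (Phase n)}
    (hZ : volume Z = 0) : volume {x | impactVel m k x ≠ 0 ∧ bypass m k x ∈ Z} = 0 := by
  have hrev : Differentiable ℝ (reversal (n := n)) := by
    unfold reversal; fun_prop
  have hd : DifferentiableOn ℝ (fun y => reversal (bypass m k (reversal y)))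
      (Z ∩ {y | impactVel m k (reversal y) ≠ 0}) := by
    intro y hy
    obtain ⟨D, hD, -⟩ := hasFDerivAt_bypass hy.2
    exact ((hrev _).comp y (hD.differentiableAt.comp y (hrev y))).differentiableWithinAt
  refine measure_mono_null ?_ (addHaar_image_eq_zero_of_differentiableOn_of_addHaar_eq_zero volume
    hd (measure_mono_null Set.inter_subset_left hZ))
  rintro x ⟨hx, hxZ⟩
  refine ⟨bypass m k x, ⟨hxZ, ?_⟩, reversal_bypass_reversal hm k hx⟩
  change impactVel m k (reversal (bypass m k x)) ≠ 0
  rw [(impactVel_reversal_bypass hm k hx).1]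
  exact hx

theorem volume_preimage_virt (hm : ∀ i, 0 < m i) : ∀ (L : List (Fin n)) {Z : Set (Phase n)},
    volume Z = 0 → volume {x | Regular m L x ∧ virt m L x ∈ Z} = 0
  | [], _, hZ => measure_mono_null (fun _ hx => hx.2) hZ
  | k :: L, Z, hZ => measure_mono_null
      (t := {x | Regular m L x ∧ virt m L x ∈ {y | impactVel m k y ≠ 0 ∧ bypass m k y ∈ Z}})
      (fun _ hx => ⟨hx.1.1, hx.1.2, hx.2⟩) (volume_preimage_virt hm L (volume_preimage_bypass hm k hZ))

theorem volume_momentum_eq_zero (hm : ∀ i, 0 < m i) {w : Fin n → ℝ} (hw : w ≠ 0) :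
    volume {x : Phase n | ∑ i, m i * (w i * vel m x i) = 0} = 0 := by
  set A : Phase n →L[ℝ] ℝ := (∑ i, w i • ContinuousLinearMap.proj (R := ℝ)
    (φ := fun _ : Fin n => ℝ) i).comp (ContinuousLinearMap.snd ℝ _ _)
  have hA : ∀ x : Phase n, A x = ∑ i, w i * x.2 i := fun x => by simp [A]
  have e : {x : Phase n | ∑ i, m i * (w i * vel m x i) = 0} = {x | A x = 0} := by
    ext x
    have : ∑ i, m i * (w i * vel m x i) = A x := by
      rw [hA]
      refine Finset.sum_congr rfl fun i _ => ?_
      have := (hm i).ne'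
      simp only [vel]
      field_simp
    change _ = _ ↔ _ = _
    rw [this]
  rw [e]
  refine volume_ker_eq_zero fun h0 => ?_
  obtain ⟨i, hi⟩ := Function.ne_iff.1 hw
  have h1 : A (0, Pi.single i 1) = 0 := by rw [h0]; rfl
  rw [hA] at h1
  simp [Pi.single_apply] at h1
  exact hi h1

theorem volume_exceptional (hm : ∀ i, 0 < m i) : volume (exceptional (n := n) m) = 0 := by
  refine measure_union_null (measure_iUnion_null fun k => ?_)
    (measure_union_null (measure_iUnion_null fun L => ?_) (measure_iUnion_null fun L => ?_))
  · exact volume_ker_eq_zero (gapPosL_ne_zero k)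
  · exact volume_preimage_virt hm L (volume_doubleContact hm)
  · by_cases h : testVector m L = 0
    · simp [h]
    · exact measure_mono_null (fun _ hx => hx.2) (volume_momentum_eq_zero hm h)

/-! ### Scaling and the energy surface -/

/-- The scaling of space by `a ^ 2` and of time by `a`. -/
def scale (a : ℝ) (x : Phase n) : Phase n := (a ^ 2 • x.1, a • x.2)

theorem vel_scale (a : ℝ) (x : Phase n) : vel m (scale a x) = fun i => a * vel m x i := by
  funext i
  simp [vel, scale, mul_div_assoc]

theorem gap_scale (a : ℝ) (x : Phase n) (k : Fin n) :
    gap (scale a x).1 k = a ^ 2 * gap x.1 k :=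
  gap_const_mul _ _ _

theorem impactVel_scale {a : ℝ} (ha : 0 < a) (x : Phase n) (k : Fin n) :
    impactVel m k (scale a x) = a * impactVel m k x := by
  unfold impactVel
  rw [gap_scale, vel_scale, gap_const_mul]
  split_ifs
  · rw [show (a * gap (vel m x) k) ^ 2 + 2 * (a ^ 2 * gap x.1 k) =
      a ^ 2 * (gap (vel m x) k ^ 2 + 2 * gap x.1 k) by ring, Real.sqrt_mul (by positivity),
      Real.sqrt_sq ha.le]
    ring
  · rfl

theorem impactShift_scale {a : ℝ} (ha : 0 < a) (x : Phase n) (k : Fin n) :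
    impactShift m k (scale a x) = a ^ 2 * impactShift m k x := by
  unfold impactShift
  rw [impactVel_scale ha, gap_scale, vel_scale, gap_const_mul]
  split_ifs
  · ring
  · rfl

theorem bypass_scale {a : ℝ} (ha : 0 < a) (x : Phase n) (k : Fin n) :
    bypass m k (scale a x) = scale a (bypass m k x) := by
  unfold bypass
  rw [impactVel_scale ha, impactShift_scale ha]
  refine Prod.ext (funext fun i => ?_) (funext fun i => ?_) <;>
  · simp [scale]
    ring

theorem virt_scale {a : ℝ} (ha : 0 < a) (x : Phase n) : ∀ L : List (Fin n),
    virt m L (scale a x) = scale a (virt m L x)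
  | [] => rfl
  | k :: L => by rw [virt, virt_scale ha x L, bypass_scale ha, virt]

theorem regular_scale {a : ℝ} (ha : 0 < a) {x : Phase n} : ∀ {L : List (Fin n)},
    Regular m L x → Regular m L (scale a x)
  | [], _ => trivial
  | k :: L, h => ⟨regular_scale ha h.1, by
      rw [virt_scale ha, impactVel_scale ha]
      exact mul_ne_zero ha.ne' h.2⟩

theorem doubleContact_scale {a : ℝ} {x : Phase n} (h : x ∈ doubleContact m) :
    scale a x ∈ doubleContact m := by
  obtain ⟨k, l, hkl, t, hk, hl⟩ := h
  have key : ∀ k, gap (fly m (a * t) (scale a x)).1 k = a ^ 2 * gap (fly m t x).1 k := by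
    intro k
    rw [gap_fly, gap_fly, gap_scale, vel_scale, gap_const_mul]
    ring
  exact ⟨k, l, hkl, a * t, by rw [key, hk, mul_zero], by rw [key, hl, mul_zero]⟩

/-- Every defining condition is homogeneous under the scaling symmetry, and the test vectors depend
on words only. -/
theorem exceptional_scale {a : ℝ} (ha : 0 < a) {x : Phase n} (h : x ∈ exceptional m) :
    scale a x ∈ exceptional m := by
  simp only [exceptional, Set.mem_union, Set.mem_iUnion] at h ⊢
  rcases h with ⟨k, h⟩ | ⟨L, h⟩ | ⟨L, h0, h⟩
  · refine Or.inl ⟨k, ?_⟩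
    change gap (scale a x).1 k = 0
    rw [gap_scale, show gap x.1 k = 0 from h, mul_zero]
  · refine Or.inr (Or.inl ⟨L, regular_scale ha h.1, ?_⟩)
    rw [virt_scale ha]
    exact doubleContact_scale h.2
  · refine Or.inr (Or.inr ⟨L, h0, ?_⟩)
    rw [vel_scale, ← mul_zero a, ← h, Finset.mul_sum]
    exact Finset.sum_congr rfl fun i _ => by ring

theorem scale_scale (a b : ℝ) (x : Phase n) : scale a (scale b x) = scale (a * b) x := by
  refine Prod.ext ?_ ?_ <;> simp [scale, smul_smul, mul_pow]

theorem energy_scale (a : ℝ) (x : Phase n) : energy m (scale a x) = a ^ 2 * energy m x := by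
  unfold energy
  rw [Finset.mul_sum]
  refine Finset.sum_congr rfl fun i _ => ?_
  simp [scale]
  ring

theorem differentiable_energy : Differentiable ℝ (energy (n := n) m) := fun x => by
  obtain ⟨L, hL, -⟩ := hasFDerivAt_energy m x
  exact hL.differentiableAt

theorem continuous_energyProj : Continuous (energyProj (n := n) m) := by
  have := (differentiable_energy (m := m)).continuous
  unfold energyProj
  fun_prop

theorem measurableSet_energySurface : MeasurableSet (energySurface (n := n) m) := by
  have h1 : IsClosed (phaseSpace n) := by
    have : phaseSpace n = ⋂ k, {x : Phase n | 0 ≤ gap x.1 k} := by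
      ext x; simp [phaseSpace]
    rw [this]
    exact isClosed_iInter fun k =>
      isClosed_le continuous_const ((continuous_gap k).comp continuous_fst)
  exact (h1.inter (isClosed_eq differentiable_energy.continuous
    continuous_const)).measurableSet

/-- A null set could still contain a whole energy surface; scaling invariance excludes this. A point
`y` of the flow box over an exceptional `b` is recovered from the exceptional point obtained by
scaling `b` to the energy of `y`: `Θ` rescales to energy 1 and then moves along the normal field by
the excess energy. Thus the box part is covered by a differentiable image of a null set. -/
theorem volume_flowBox_exceptional (hm : ∀ i, 0 < m i) :
    volume ({x | energyProj m x ∈ energySurface m ∧ energy m x ∈ Set.Icc (1 : ℝ) 2} ∩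
      energyProj m ⁻¹' exceptional m) = 0 := by
  have hH := differentiable_energy (m := m)
  set Θ : Phase n → Phase n := fun z =>
    scale (√(energy m z))⁻¹ z + (energy m z - 1) • normalField m with hΘ
  have hd : DifferentiableOn ℝ Θ (exceptional m ∩ {z | 0 < energy m z}) := by
    intro z hz
    have hpos : 0 < energy m z := hz.2
    have h1 : DifferentiableAt ℝ (fun z => (√(energy m z))⁻¹) z :=
      ((hH z).sqrt hpos.ne').inv (Real.sqrt_pos.2 hpos).ne'
    have h2 : DifferentiableAt ℝ (energy m) z := hH z
    refine DifferentiableAt.differentiableWithinAt ?_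
    simp only [hΘ, scale]
    fun_prop
  refine measure_mono_null ?_ (addHaar_image_eq_zero_of_differentiableOn_of_addHaar_eq_zero volume
    hd (measure_mono_null Set.inter_subset_left (volume_exceptional hm)))
  rintro y ⟨⟨hy, hy1⟩, hye⟩
  set b := energyProj m y with hb
  have hE : 0 < energy m y := lt_of_lt_of_le one_pos hy1.1
  set a := √(energy m y)
  have ha : 0 < a := Real.sqrt_pos.2 hE
  have hab : energy m (scale a b) = energy m y := by
    rw [energy_scale, hy.2, mul_one, Real.sq_sqrt hE.le]
  refine ⟨scale a b, ⟨exceptional_scale ha hye, ?_⟩, ?_⟩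
  · change 0 < energy m (scale a b)
    rw [hab]; exact hE
  · simp only [hΘ, hab]
    change scale a⁻¹ (scale a b) + _ = _
    rw [scale_scale, inv_mul_cancel₀ ha.ne']
    have : scale 1 b = b := by simp [scale]
    rw [this, hb, energyProj, add_assoc, ← add_smul]
    simp

end FallingBalls

end

-- The order of the masses plays no role in the argument.
theorem lemma3p4 (n : ℕ) (hn : 2 ≤ n) (m : Fin n → ℝ) (hpos : ∀ i, 0 < m i)
    (hanti : Antitone m) (h12 : m ⟨1, by omega⟩ < m ⟨0, by omega⟩) :
    ∀ᵐ x ∂(FallingBalls.liouville m),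
      x ∈ FallingBalls.energySurface m ∧ FallingBalls.Nonsingular m x ∧
        FallingBalls.neutralSpace m x = {0} := by
  open FallingBalls in
  have hproj := (continuous_energyProj (m := m)).measurable
  have hE : MeasurableSet
      {x : Phase n | energyProj m x ∈ energySurface m ∧ energy m x ∈ Set.Icc (1 : ℝ) 2} :=
    (hproj measurableSet_energySurface).inter
      (differentiable_energy.continuous.measurable measurableSet_Icc)
  -- Measurability is required to pull the statement back through the pushforward, so the explicit
  -- set `exceptional` stands in for the conclusion.
  have hgood : MeasurableSet {x : Phase n | x ∈ energySurface m ∧ x ∉ exceptional m} :=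
    measurableSet_energySurface.inter measurableSet_exceptional.compl
  have key : ∀ᵐ x ∂(liouville m), x ∈ energySurface m ∧ x ∉ exceptional m := by
    refine Measure.ae_smul_measure ?_ _
    rw [ae_map_iff hproj.aemeasurable hgood, ae_restrict_iff' hE]
    refine measure_mono_null ?_ (volume_flowBox_exceptional hpos)
    intro y hy
    simp only [Set.mem_compl_iff, Set.mem_ofPred_eq, Classical.not_imp, not_and, not_not] at hy
    exact ⟨hy.1, hy.2 hy.1.1⟩
  filter_upwards [key] with x hx
  exact ⟨hx.1, of_notMem_exceptional hpos (by omega) hx.1 hx.2⟩
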